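/- For a complex $m\times n$ matrix $X$ let $F_X:(\mathbb C^n,\|\cdot\|_\infty)\to(\mathbb C^m,\|\cdot\|_2)$ be the operator with matrix $X$. Let $\|X\|_F$ be its operator norm and $\|X\|_{cbF}$ its completely bounded norm, where $(\mathbb C^n,\|\cdot\|_\infty)$ is regarded as the abelian C*-algebra $C(\{1,\dots,n\})$ and $(\mathbb C^m,\|\cdot\|_2)$ as the column Hilbert space $M_{m,1}(\mathbb C)$; explicitly, $$\|X\|_{cbF}=\sup_{k\ge 1}\ \sup\Big\{\Big\|\Big(\sum_{j=1}^n X_{ij}\,a_j\Big)_{i=1}^m\Big\| \ :\ a_1,\dots,a_n\in M_k(\mathbb C),\ \max_j\|a_j\|\le 1\Big\},$$ where the $m$ blocks are stacked into an $mk\times k$ matrix and norms of matrices are operator norms. Let $k_G^{\mathbb C}$ (the complex little Grothendieck constant) be the best constant in the inequality $\|X\|_{cbF}\le\sqrt{k_G^{\mathbb C}}\,\|X\|_F$, that is, the infimum of all $c>0$ such that $\|X\|_{cbF}\le\sqrt c\,\|X\|_F$ for all complex matrices $X$ of all sizes. Let $\|X\|_S$ be the Schur multiplier norm, that is, the norm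 of the map $A\mapsto (X_{ij}A_{ij})$ on the space $M_{m,n}(\mathbb C)$ equipped with the operator norm, and let $$\mathcal V=\overline{\mathrm{conv}}\big\{(u_iv_j)_{i,j}\ :\ u\in\mathbb C^m,\ v\in\mathbb C^n,\ |u_i|=|v_j|=1\ \text{for all } i,j\big\}\subseteq M_{m,n}(\mathbb C).$$ **Theorem.** Let $X$ be a complex $m\times n$ matrix with $\|X\|_S=1$. Then $$X\in\frac{k_G^{\mathbb C}}{2-k_G^{\mathbb C}}\,\mathcal V .$$ -/

import Mathlib

open scoped Pointwise

noncomputable section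

namespace Grothendieck

/-- The operator `F_X : (ℂⁿ, ‖·‖_∞) → (ℂᵐ, ‖·‖₂)` with matrix `X`. The norm of `Fin n → ℂ` is
the sup norm, so this domain is the abelian C*-algebra `C({1, …, n}, ℂ)`. -/
def FMap {m n : ℕ} (X : Matrix (Fin m) (Fin n) ℂ) :
    (Fin n → ℂ) →L[ℂ] EuclideanSpace ℂ (Fin m) :=
  LinearMap.toContinuousLinearMap
    ((WithLp.linearEquiv 2 ℂ (Fin m → ℂ)).symm.toLinearMap ∘ₗ X.mulVecLin)

/-- `‖X‖_F`, the norm of `F_X`. -/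
def normF {m n : ℕ} (X : Matrix (Fin m) (Fin n) ℂ) : ℝ := ‖FMap X‖

open scoped Matrix.Norms.L2Operator in
/-- The `k`-th amplification `M_k(C({1, …, n})) → M_k(ℂᵐ)` of `F_X`, where `ℂᵐ` is the column
Hilbert space `M_{m,1}(ℂ)`. Here `M_k(C({1, …, n}))` is the algebra of functions from
`{1, …, n}` to `M_k(ℂ)` with the maximum of the operator norms, and `M_k(M_{m,1}(ℂ))` is the
space of `mk × k` matrices with the operator norm. -/
def FAmp {m n : ℕ} (X : Matrix (Fin m) (Fin n) ℂ) (k : ℕ) :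
    (Fin n → Matrix (Fin k) (Fin k) ℂ) →L[ℂ] Matrix (Fin m × Fin k) (Fin k) ℂ :=
  LinearMap.toContinuousLinearMap
    { toFun := fun a => Matrix.of fun p q => ∑ j, X p.1 j * a j p.2 q
      map_add' := fun a b => by
        ext p q
        simp [mul_add, Finset.sum_add_distrib]
      map_smul' := fun c a => by
        ext p q
        simp [Finset.mul_sum, mul_left_comm] }

open scoped Matrix.Norms.L2Operator in
/-- `‖X‖_cbF`, the completely bounded norm of `F_X`: the supremum of the norms of all its
amplifications. -/
def normCbF {m n : ℕ} (X : Matrix (Fin m) (Fin n) ℂ) : ℝ := ⨆ k : ℕ, ‖FAmp X k‖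

/-- The complex little Grothendieck constant: the best constant in the inequality
`‖X‖_cbF ≤ √c ‖X‖_F` for complex matrices of all sizes. -/
def littleGrothendieckConst : ℝ :=
  sInf {c : ℝ | 0 < c ∧ ∀ (m n : ℕ) (X : Matrix (Fin m) (Fin n) ℂ),
    normCbF X ≤ Real.sqrt c * normF X}

open scoped Matrix.Norms.L2Operator in
/-- Schur multiplication by `X` on the complex `m × n` matrices with the operator norm. -/
def schurMap {m n : ℕ} (X : Matrix (Fin m) (Fin n) ℂ) :
    Matrix (Fin m) (Fin n) ℂ →L[ℂ] Matrix (Fin m) (Fin n) ℂ :=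
  LinearMap.toContinuousLinearMap
    { toFun := fun A => Matrix.hadamard X A
      map_add' := fun A B => Matrix.hadamard_add X A B
      map_smul' := fun c A => Matrix.hadamard_smul X A c }

open scoped Matrix.Norms.L2Operator in
/-- `‖X‖_S`, the Schur multiplier norm. -/
def schurNorm {m n : ℕ} (X : Matrix (Fin m) (Fin n) ℂ) : ℝ := ‖schurMap X‖

/-- The closed convex hull of the rank one matrices `(u_i v_j)` with `u` and `v` vectors all of
whose entries have modulus one. -/
def rankOneHull (m n : ℕ) : Set (Matrix (Fin m) (Fin n) ℂ) :=
  closure (convexHull ℝ {A | ∃ (u : Fin m → ℂ) (v : Fin n → ℂ),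
    (∀ i, ‖u i‖ = 1) ∧ (∀ j, ‖v j‖ = 1) ∧ A = Matrix.vecMulVec u v})

end Grothendieck

end

/-! Write `k` for the little Grothendieck constant. Testing the amplifications of `F_X` on vectors
turns the defining inequality into `∑ i, ‖∑ j, X i j • v j‖ ^ 2 ≤ k * normF X ^ 2` for vectors `v j`
of norm at most one in any finite-dimensional Hilbert space.

By Hahn–Banach this dualises: every positive `C` with diagonal at most one satisfies `C ≤ k • A` for
some `A` in the closed convex hull of the matrices `a a*` with `a` in the polydisc
(`exists_polydiscHull_sub_posSemidef`).

A Schur multiplier of norm one is the off-diagonal block of a positive matrix `M` with diagonal at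
most one (`exists_posSemidef_block`). The diagonal can be raised to exactly one. Then `k • A - M` is
positive with diagonal at most `k - 1`, and its block is `k • V - X` with `V` in the rank one hull.
So `X` is `k • V` up to an error of the same kind, smaller by the factor `k - 1`. Since `k < 2`, the
error can be absorbed: if `s` is the supremum of a linear functional over all such blocks and `h`
bounds it on the rank one hull, then `s ≤ k * h + (k - 1) * s`, whence `s ≤ k / (2 - k) * h`.
Separating a point from the closed convex set `k / (2 - k) • rankOneHull` finishes the proof.

The strict bound `k < 2` comes from `k ≤ 4 / π`, which is proved by Gaussian averaging. -/

namespace Grothendieck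

open MeasureTheory ComplexConjugate

/-! ### The standard complex Gaussian weight -/

section Gaussian

variable {ι : Type*} [Fintype ι]

/-- The (unnormalised) density of the standard complex Gaussian measure on `ι → ℂ`. -/
noncomputable def gaussWeight (x : ι → ℂ) : ℝ := ∏ i, Real.exp (-‖x i‖ ^ 2)

lemma gaussWeight_nonneg (x : ι → ℂ) : 0 ≤ gaussWeight x :=
  Finset.prod_nonneg fun _ _ => (Real.exp_pos _).le

lemma gaussWeight_eq (x : ι → ℂ) :
    gaussWeight x = Real.exp (-‖(WithLp.toLp 2 x : EuclideanSpace ℂ ι)‖ ^ 2) := by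
  rw [gaussWeight, ← Real.exp_sum, EuclideanSpace.norm_sq_eq, Finset.sum_neg_distrib]

/-! ### Radial moments of the Gaussian in one complex variable. -/

lemma integral_norm_rpow_mul_exp {q : ℝ} (hq : 0 ≤ q) :
    ∫ z : ℂ, ‖z‖ ^ q * Real.exp (-‖z‖ ^ 2) = Real.pi * Real.Gamma ((q + 2) / 2) := by
  have h := Complex.integral_rpow_mul_exp_neg_rpow (p := 2) (q := q) (by norm_num) (by linarith)
  simp only [Real.rpow_two] at h
  rw [h]; ring

lemma integrable_norm_rpow_mul_exp {q : ℝ} (hq : 0 ≤ q) :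
    Integrable fun z : ℂ => ‖z‖ ^ q * Real.exp (-‖z‖ ^ 2) := by
  apply Integrable.of_integral_ne_zero
  rw [integral_norm_rpow_mul_exp hq]
  have := Real.Gamma_pos_of_pos (s := (q + 2) / 2) (by linarith)
  positivity

lemma integrable_exp_neg_normSq : Integrable fun z : ℂ => Real.exp (-‖z‖ ^ 2) := by
  simpa using integrable_norm_rpow_mul_exp (q := 0) le_rfl

lemma integral_exp_neg_normSq : ∫ z : ℂ, Real.exp (-‖z‖ ^ 2) = Real.pi := by
  simpa using integral_norm_rpow_mul_exp (q := 0) le_rfl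

lemma integrable_norm_mul_exp : Integrable fun z : ℂ => ‖z‖ * Real.exp (-‖z‖ ^ 2) := by
  simpa using integrable_norm_rpow_mul_exp (q := 1) zero_le_one

lemma integral_norm_mul_exp :
    ∫ z : ℂ, ‖z‖ * Real.exp (-‖z‖ ^ 2) = Real.pi * (√Real.pi / 2) := by
  have h := integral_norm_rpow_mul_exp (q := 1) zero_le_one
  simp only [Real.rpow_one] at h
  rw [h, show ((1 : ℝ) + 2) / 2 = 1 / 2 + 1 by norm_num, Real.Gamma_add_one (by norm_num),
    Real.Gamma_one_half_eq]
  ring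

lemma integrable_normSq_mul_exp : Integrable fun z : ℂ => ‖z‖ ^ 2 * Real.exp (-‖z‖ ^ 2) := by
  simpa using integrable_norm_rpow_mul_exp (q := 2) zero_le_two

lemma integral_normSq_mul_exp : ∫ z : ℂ, ‖z‖ ^ 2 * Real.exp (-‖z‖ ^ 2) = Real.pi := by
  have h := integral_norm_rpow_mul_exp (q := 2) zero_le_two
  simp only [Real.rpow_two] at h
  rw [h, show ((2 : ℝ) + 2) / 2 = 1 + 1 by norm_num, Real.Gamma_add_one (by norm_num),
    Real.Gamma_one]
  ring

lemma integrable_gaussWeight : Integrable (gaussWeight : (ι → ℂ) → ℝ) :=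
  Integrable.fintype_prod (f := fun (_ : ι) (z : ℂ) => Real.exp (-‖z‖ ^ 2))
    fun _ => integrable_exp_neg_normSq

lemma integral_gaussWeight : ∫ x : ι → ℂ, gaussWeight x = Real.pi ^ Fintype.card ι := by
  have := integral_fintype_prod_volume_eq_prod
    (f := fun (_ : ι) (z : ℂ) => Real.exp (-‖z‖ ^ 2))
  simp only [integral_exp_neg_normSq, Finset.prod_const, Finset.card_univ] at this
  exact this

/-- The linear isometry `e` as a real linear map on the underlying function space. -/
noncomputable def isometryPi (e : EuclideanSpace ℂ ι ≃ₗᵢ[ℂ] EuclideanSpace ℂ ι) :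
    (ι → ℂ) ≃ₗ[ℝ] (ι → ℂ) :=
  (((WithLp.linearEquiv 2 ℂ (ι → ℂ)).symm.trans e.toLinearEquiv).trans
    (WithLp.linearEquiv 2 ℂ (ι → ℂ))).restrictScalars ℝ

lemma isometryPi_apply (e : EuclideanSpace ℂ ι ≃ₗᵢ[ℂ] EuclideanSpace ℂ ι) (x : ι → ℂ) :
    isometryPi e x = WithLp.ofLp (e (WithLp.toLp 2 x)) := rfl

lemma gaussWeight_isometryPi (e : EuclideanSpace ℂ ι ≃ₗᵢ[ℂ] EuclideanSpace ℂ ι) (x : ι → ℂ) :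
    gaussWeight (isometryPi e x) = gaussWeight x := by
  rw [gaussWeight_eq, gaussWeight_eq, isometryPi_apply, WithLp.toLp_ofLp,
    LinearIsometryEquiv.norm_map]

lemma isometryPi_measurableEmbedding (e : EuclideanSpace ℂ ι ≃ₗᵢ[ℂ] EuclideanSpace ℂ ι) :
    MeasurableEmbedding (isometryPi e) :=
  ((isometryPi e).toContinuousLinearEquiv.toHomeomorph).measurableEmbedding

/-- A linear bijection multiplies Lebesgue measure by a constant. The Gaussian weight is invariant
under the isometry and has finite nonzero integral, so this constant is one. -/
lemma measurePreserving_isometryPi (e : EuclideanSpace ℂ ι ≃ₗᵢ[ℂ] EuclideanSpace ℂ ι) :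
    MeasurePreserving (isometryPi e) := by
  have hdet : LinearMap.det (isometryPi e : (ι → ℂ) →ₗ[ℝ] (ι → ℂ)) ≠ 0 :=
    (LinearEquiv.isUnit_det' _).ne_zero
  have hmap := Measure.map_linearMap_addHaar_eq_smul_addHaar
    (volume : Measure (ι → ℂ)) hdet
  set c : ℝ := |(LinearMap.det (isometryPi e : (ι → ℂ) →ₗ[ℝ] (ι → ℂ)))⁻¹| with hc
  have hme := isometryPi_measurableEmbedding e
  have h1 : ∫ x : ι → ℂ, gaussWeight x ∂(Measure.map (isometryPi e) volume)
      = ∫ x : ι → ℂ, gaussWeight x := by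
    rw [hme.integral_map]
    simp only [gaussWeight_isometryPi]
  have hmap' : Measure.map (isometryPi e) volume = ENNReal.ofReal c • volume := hmap
  have h2 : c = 1 := by
    rw [hmap', integral_smul_measure, integral_gaussWeight,
      ENNReal.toReal_ofReal (abs_nonneg _), smul_eq_mul] at h1
    have hp : Real.pi ^ Fintype.card ι ≠ 0 := pow_ne_zero _ Real.pi_ne_zero
    exact mul_right_cancel₀ hp (by rw [h1, one_mul])
  refine ⟨hme.measurable, ?_⟩
  rw [hmap', h2]; simp

variable [DecidableEq ι]

lemma gaussWeight_coord_eq_prod (i₀ p : ι) (H : ℂ → ℂ) (x : ι → ℂ) :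
    (gaussWeight x : ℂ) * (conj (x p) * H (x i₀)) =
      ∏ i, ((Real.exp (-‖x i‖ ^ 2) : ℂ) * ((if i = p then conj (x i) else 1) *
        (if i = i₀ then H (x i) else 1))) := by
  rw [Finset.prod_mul_distrib, Finset.prod_mul_distrib, Finset.prod_ite_eq',
    Finset.prod_ite_eq', gaussWeight]
  simp

lemma integrable_conj_mul_exp :
    Integrable fun z : ℂ => (Real.exp (-‖z‖ ^ 2) : ℂ) * conj z := by
  refine integrable_norm_mul_exp.mono' (by fun_prop) (Filter.Eventually.of_forall fun z => ?_)
  rw [norm_mul, RCLike.norm_conj, Complex.norm_real, Real.norm_of_nonneg (Real.exp_pos _).le,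
    mul_comm]

lemma integral_conj_mul_exp : ∫ z : ℂ, (Real.exp (-‖z‖ ^ 2) : ℂ) * conj z = 0 := by
  have h := integral_neg_eq_self (fun z : ℂ => (Real.exp (-‖z‖ ^ 2) : ℂ) * conj z) volume
  simp only [norm_neg, map_neg, mul_neg, integral_neg] at h
  exact self_eq_neg.mp h.symm

lemma integrable_gaussWeight_coord {H : ℂ → ℂ}
    (h0 : Integrable fun z : ℂ => (Real.exp (-‖z‖ ^ 2) : ℂ) * H z)
    (h1 : Integrable fun z : ℂ => (Real.exp (-‖z‖ ^ 2) : ℂ) * (conj z * H z)) (i₀ p : ι) :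
    Integrable fun x : ι → ℂ => (gaussWeight x : ℂ) * (conj (x p) * H (x i₀)) := by
  simp only [gaussWeight_coord_eq_prod]
  refine Integrable.fintype_prod (f := fun (i : ι) (z : ℂ) => (Real.exp (-‖z‖ ^ 2) : ℂ) *
    ((if i = p then conj z else 1) * (if i = i₀ then H z else 1))) fun i => ?_
  by_cases hp : i = p
  · by_cases hi : i = i₀
    · simpa only [if_pos hp, if_pos hi] using h1
    · simpa only [if_pos hp, if_neg hi, mul_one] using integrable_conj_mul_exp
  · by_cases hi : i = i₀
    · simpa only [if_neg hp, if_pos hi, one_mul] using h0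
    · simp only [if_neg hp, if_neg hi, mul_one]
      exact integrable_exp_neg_normSq.ofReal

/-- The integral factorises over the coordinates. If `p ≠ i₀`, the factor at `p` is the mean of
`conj z`, which vanishes by symmetry. -/
lemma integral_gaussWeight_coord (H : ℂ → ℂ) (i₀ p : ι) :
    ∫ x : ι → ℂ, (gaussWeight x : ℂ) * (conj (x p) * H (x i₀)) =
      if p = i₀ then (Real.pi : ℂ) ^ (Fintype.card ι - 1) *
        ∫ z : ℂ, (Real.exp (-‖z‖ ^ 2) : ℂ) * (conj z * H z) else 0 := by
  simp only [gaussWeight_coord_eq_prod]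
  rw [integral_fintype_prod_volume_eq_prod (f := fun (i : ι) (z : ℂ) =>
    (Real.exp (-‖z‖ ^ 2) : ℂ) * ((if i = p then conj z else 1) * (if i = i₀ then H z else 1)))]
  split_ifs with h
  · subst h
    rw [← Finset.prod_erase_mul _ _ (Finset.mem_univ p)]
    congr 1
    · rw [Finset.prod_congr rfl (g := fun _ => (Real.pi : ℂ)), Finset.prod_const,
        Finset.card_erase_of_mem (Finset.mem_univ p), Finset.card_univ]
      intro i hi
      simp only [if_neg (Finset.ne_of_mem_erase hi), mul_one]
      rw [integral_complex_ofReal, integral_exp_neg_normSq]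
    · simp
  · refine Finset.prod_eq_zero (Finset.mem_univ p) ?_
    simp only [if_neg h, if_true, mul_one]
    exact integral_conj_mul_exp

/-- If `H` has enough integrability then, for a unit vector `u`, the Gaussian correlation of a
linear form with `H ∘ ⟪u, ·⟫` depends on the linear form through its coefficient along `u`. -/
lemma gauss_inner_correlation {H : ℂ → ℂ}
    (h0 : Integrable fun z : ℂ => (Real.exp (-‖z‖ ^ 2) : ℂ) * H z)
    (h1 : Integrable fun z : ℂ => (Real.exp (-‖z‖ ^ 2) : ℂ) * (conj z * H z))
    (u w : EuclideanSpace ℂ ι) (hu : ‖u‖ = 1) :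
    Integrable (fun x : ι → ℂ => (gaussWeight x : ℂ) *
      (inner ℂ (WithLp.toLp 2 x) w * H (inner ℂ u (WithLp.toLp 2 x)))) ∧
    ∫ x : ι → ℂ, (gaussWeight x : ℂ) *
      (inner ℂ (WithLp.toLp 2 x) w * H (inner ℂ u (WithLp.toLp 2 x))) =
      (Real.pi : ℂ) ^ (Fintype.card ι - 1) *
        (∫ z : ℂ, (Real.exp (-‖z‖ ^ 2) : ℂ) * (conj z * H z)) * inner ℂ u w := by
  obtain ⟨i₀⟩ : Nonempty ι := by
    by_contra hne
    rw [not_nonempty_iff] at hne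
    have : u = 0 := Subsingleton.elim _ _
    simp [this] at hu
  -- Rotating by a basis that contains `u` turns `⟪u, x⟫` into a single coordinate; only the
  -- coefficient of `w` along `u` then survives.
  obtain ⟨b, hb⟩ := Orthonormal.exists_orthonormalBasis_extension_of_card_eq (𝕜 := ℂ)
    (ι := ι) (E := EuclideanSpace ℂ ι) (by simp) (v := fun _ => u) (s := {i₀})
    (by
      refine ⟨fun i => hu, fun i j hij => ?_⟩
      exact absurd (Subsingleton.elim i j) hij)
  have hb0 : b i₀ = u := hb i₀ rfl
  have hF : ∀ x : ι → ℂ, (gaussWeight x : ℂ) *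
      (inner ℂ (WithLp.toLp 2 x) w * H (inner ℂ u (WithLp.toLp 2 x))) =
      (fun y : ι → ℂ => ∑ p, (b.repr w p) * ((gaussWeight y : ℂ) * (conj (y p) * H (y i₀))))
        (isometryPi b.repr x) := by
    intro x
    beta_reduce
    rw [gaussWeight_isometryPi]
    simp only [isometryPi_apply]
    have e1 : inner ℂ u (WithLp.toLp 2 x) = b.repr (WithLp.toLp 2 x) i₀ := by
      rw [b.repr_apply_apply, hb0]
    have e2 : inner ℂ (WithLp.toLp 2 x) w
        = ∑ p, (b.repr w p) * conj (b.repr (WithLp.toLp 2 x) p) := by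
      rw [← b.repr.inner_map_map, PiLp.inner_apply]
      simp
    rw [e1, e2, Finset.sum_mul, Finset.mul_sum]
    exact Finset.sum_congr rfl fun p _ => by ring
  have hint : Integrable (fun y : ι → ℂ =>
      ∑ p, (b.repr w p) * ((gaussWeight y : ℂ) * (conj (y p) * H (y i₀)))) :=
    integrable_finsetSum _ fun p _ => (integrable_gaussWeight_coord h0 h1 i₀ p).const_mul _
  have hmp := measurePreserving_isometryPi b.repr
  have hme := isometryPi_measurableEmbedding b.repr
  refine ⟨?_, ?_⟩
  · simp only [hF]
    exact (hmp.integrable_comp_emb hme).2 hint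
  · simp only [hF]
    rw [hmp.integral_comp hme (fun y : ι → ℂ =>
      ∑ p, (b.repr w p) * ((gaussWeight y : ℂ) * (conj (y p) * H (y i₀)))), integral_finsetSum _ fun p _ =>
      (integrable_gaussWeight_coord h0 h1 i₀ p).const_mul _]
    simp only [integral_const_mul, integral_gaussWeight_coord]
    rw [Finset.sum_eq_single i₀ (fun p _ hp => by simp [hp]) (by simp)]
    rw [if_pos rfl, b.repr_apply_apply, hb0]
    ring

/-- The phase `z / |z|` of a complex number (zero at zero). -/
noncomputable def phase (z : ℂ) : ℂ := z / (‖z‖ : ℂ)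

lemma norm_phase_le (z : ℂ) : ‖phase z‖ ≤ 1 := by
  rw [phase, norm_div, Complex.norm_real, norm_norm]
  exact div_self_le_one _

lemma conj_mul_phase (z : ℂ) : conj z * phase z = (‖z‖ : ℂ) := by
  rw [phase, mul_div_assoc', mul_comm, Complex.mul_conj, Complex.normSq_eq_norm_sq]
  by_cases h : ‖z‖ = 0
  · simp [h]
  · push_cast
    field_simp

lemma measurable_phase : Measurable phase := by
  unfold phase; fun_prop

lemma gauss_inner_mul_inner (u w : EuclideanSpace ℂ ι) :
    Integrable (fun x : ι → ℂ => (gaussWeight x : ℂ) *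
      (inner ℂ (WithLp.toLp 2 x) w * inner ℂ u (WithLp.toLp 2 x))) ∧
    ∫ x : ι → ℂ, (gaussWeight x : ℂ) *
      (inner ℂ (WithLp.toLp 2 x) w * inner ℂ u (WithLp.toLp 2 x)) =
      (Real.pi : ℂ) ^ (Fintype.card ι) * inner ℂ u w := by
  by_cases hu : u = 0
  · simp [hu]
  have hu' : (‖u‖ : ℂ) ≠ 0 := by simpa using hu
  have e (z : ℂ) : (Real.exp (-‖z‖ ^ 2) : ℂ) * (conj z * z)
      = ((‖z‖ ^ 2 * Real.exp (-‖z‖ ^ 2) : ℝ) : ℂ) := by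
    rw [mul_comm (conj z), Complex.mul_conj, Complex.normSq_eq_norm_sq]; push_cast; ring
  have hcard : 0 < Fintype.card ι := by
    rw [Fintype.card_pos_iff]
    by_contra hne
    rw [not_nonempty_iff] at hne
    exact hu (Subsingleton.elim _ _)
  obtain ⟨hi, hv⟩ := gauss_inner_correlation (ι := ι) (H := fun z => z)
    (by
      refine integrable_norm_mul_exp.mono' (by fun_prop) (Filter.Eventually.of_forall fun z => ?_)
      rw [norm_mul, Complex.norm_real, Real.norm_of_nonneg (Real.exp_pos _).le, mul_comm])
    (by simp only [e]; exact integrable_normSq_mul_exp.ofReal)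
    ((‖u‖ : ℂ)⁻¹ • u) w (by rw [norm_smul]; simp [hu])
  have key (x : ι → ℂ) : (gaussWeight x : ℂ) *
      (inner ℂ (WithLp.toLp 2 x) w * inner ℂ u (WithLp.toLp 2 x)) = (‖u‖ : ℂ) *
      ((gaussWeight x : ℂ) * (inner ℂ (WithLp.toLp 2 x) w *
        inner ℂ ((‖u‖ : ℂ)⁻¹ • u) (WithLp.toLp 2 x))) := by
    rw [inner_smul_left]
    simp only [map_inv₀, Complex.conj_ofReal]
    field_simp
  refine ⟨by simp only [key]; exact hi.const_mul _, ?_⟩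
  simp only [key]
  rw [integral_const_mul, hv]
  simp only [e]
  rw [integral_complex_ofReal, integral_normSq_mul_exp, inner_smul_left]
  simp only [map_inv₀, Complex.conj_ofReal]
  obtain ⟨d, hd⟩ := Nat.exists_eq_succ_of_ne_zero hcard.ne'
  rw [hd, Nat.succ_sub_one, pow_succ]
  field_simp

/-- The phase ignores positive scaling, so `u` can be normalised. The factor `√π / 2` is the
normalised Gaussian mean of `‖z‖`: replacing a Gaussian variable by its phase keeps all correlations
with linear forms up to this factor. -/
lemma gauss_inner_mul_phase (u w : EuclideanSpace ℂ ι) :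
    Integrable (fun x : ι → ℂ => (gaussWeight x : ℂ) *
      (inner ℂ (WithLp.toLp 2 x) w * (‖u‖ * phase (inner ℂ u (WithLp.toLp 2 x))))) ∧
    ∫ x : ι → ℂ, (gaussWeight x : ℂ) *
      (inner ℂ (WithLp.toLp 2 x) w * (‖u‖ * phase (inner ℂ u (WithLp.toLp 2 x)))) =
      (Real.pi : ℂ) ^ (Fintype.card ι) * ((√Real.pi / 2 : ℝ) * inner ℂ u w) := by
  by_cases hu : u = 0
  · simp [hu]
  have hu' : (‖u‖ : ℂ) ≠ 0 := by simpa using hu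
  have e (z : ℂ) : (Real.exp (-‖z‖ ^ 2) : ℂ) * (conj z * phase z)
      = ((‖z‖ * Real.exp (-‖z‖ ^ 2) : ℝ) : ℂ) := by
    rw [conj_mul_phase]; push_cast; ring
  have hcard : 0 < Fintype.card ι := by
    rw [Fintype.card_pos_iff]
    by_contra hne
    rw [not_nonempty_iff] at hne
    exact hu (Subsingleton.elim _ _)
  obtain ⟨hi, hv⟩ := gauss_inner_correlation (ι := ι) (H := phase)
    (by
      refine integrable_exp_neg_normSq.mono' ?_ (Filter.Eventually.of_forall fun z => ?_)
      · have := measurable_phase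
        exact Measurable.aestronglyMeasurable (by fun_prop)
      rw [norm_mul, Complex.norm_real, Real.norm_of_nonneg (Real.exp_pos _).le]
      exact mul_le_of_le_one_right (Real.exp_pos _).le (norm_phase_le z))
    (by simp only [e]; exact integrable_norm_mul_exp.ofReal)
    ((‖u‖ : ℂ)⁻¹ • u) w (by rw [norm_smul]; simp [hu])
  have key (x : ι → ℂ) : (gaussWeight x : ℂ) *
      (inner ℂ (WithLp.toLp 2 x) w * (‖u‖ * phase (inner ℂ u (WithLp.toLp 2 x)))) = (‖u‖ : ℂ) *
      ((gaussWeight x : ℂ) * (inner ℂ (WithLp.toLp 2 x) w *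
        phase (inner ℂ ((‖u‖ : ℂ)⁻¹ • u) (WithLp.toLp 2 x)))) := by
    have : phase (inner ℂ ((‖u‖ : ℂ)⁻¹ • u) (WithLp.toLp 2 x))
        = phase (inner ℂ u (WithLp.toLp 2 x)) := by
      rw [inner_smul_left, phase, phase]
      simp only [map_inv₀, Complex.conj_ofReal, norm_mul, norm_inv, Complex.norm_real, norm_norm]
      push_cast
      rw [mul_div_mul_left _ _ (inv_ne_zero hu')]
    rw [this]; ring
  refine ⟨by simp only [key]; exact hi.const_mul _, ?_⟩
  simp only [key]
  rw [integral_const_mul, hv]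
  simp only [e]
  rw [integral_complex_ofReal, integral_norm_mul_exp, inner_smul_left]
  simp only [map_inv₀, Complex.conj_ofReal]
  obtain ⟨d, hd⟩ := Nat.exists_eq_succ_of_ne_zero hcard.ne'
  rw [hd, Nat.succ_sub_one, pow_succ]
  push_cast
  field_simp

end Gaussian

end Grothendieck

namespace Grothendieck

open MeasureTheory ComplexConjugate

/-! ### The little Grothendieck inequality with constant `4 / π` -/

lemma FMap_apply {m n : ℕ} (X : Matrix (Fin m) (Fin n) ℂ) (s : Fin n → ℂ) (i : Fin m) :
    FMap X s i = ∑ j, X i j * s j := rfl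

lemma sum_norm_sq_le_normF {m n : ℕ} (X : Matrix (Fin m) (Fin n) ℂ) (s : Fin n → ℂ)
    (hs : ∀ j, ‖s j‖ ≤ 1) : ∑ i, ‖∑ j, X i j * s j‖ ^ 2 ≤ normF X ^ 2 := by
  have h1 : ‖FMap X s‖ ≤ normF X := by
    refine ((FMap X).le_opNorm s).trans (mul_le_of_le_one_right (norm_nonneg _) ?_)
    exact (pi_norm_le_iff_of_nonneg zero_le_one).2 hs
  have h2 : ‖FMap X s‖ ^ 2 = ∑ i, ‖∑ j, X i j * s j‖ ^ 2 := by
    rw [EuclideanSpace.norm_sq_eq]; simp only [FMap_apply]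
  rw [← h2]
  exact pow_le_pow_left₀ (norm_nonneg _) h1 2

lemma normF_nonneg {m n : ℕ} (X : Matrix (Fin m) (Fin n) ℂ) : 0 ≤ normF X := norm_nonneg _

section

variable {ι : Type*} [Fintype ι]

lemma gauss_sum_mul_sum {n : ℕ} (a : Fin n → ℂ) (v : Fin n → EuclideanSpace ℂ ι)
    (K : Fin n → (ι → ℂ) → ℂ) (r : ℂ)
    (hK : ∀ j l, Integrable (fun x : ι → ℂ => (gaussWeight x : ℂ) *
        (inner ℂ (WithLp.toLp 2 x) (v j) * K l x)) ∧
      ∫ x : ι → ℂ, (gaussWeight x : ℂ) * (inner ℂ (WithLp.toLp 2 x) (v j) * K l x) =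
        r * inner ℂ (v l) (v j)) :
    Integrable (fun x : ι → ℂ => (gaussWeight x : ℂ) *
      ((∑ j, a j * inner ℂ (WithLp.toLp 2 x) (v j)) * ∑ l, conj (a l) * K l x)) ∧
    ∫ x : ι → ℂ, (gaussWeight x : ℂ) *
      ((∑ j, a j * inner ℂ (WithLp.toLp 2 x) (v j)) * ∑ l, conj (a l) * K l x) =
      r * (‖∑ j, a j • v j‖ ^ 2 : ℝ) := by
  have e (x : ι → ℂ) : (gaussWeight x : ℂ) *
      ((∑ j, a j * inner ℂ (WithLp.toLp 2 x) (v j)) * ∑ l, conj (a l) * K l x) =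
      ∑ j, ∑ l, a j * conj (a l) *
        ((gaussWeight x : ℂ) * (inner ℂ (WithLp.toLp 2 x) (v j) * K l x)) := by
    rw [Finset.sum_mul_sum, Finset.mul_sum]
    refine Finset.sum_congr rfl fun j _ => ?_
    rw [Finset.mul_sum]
    exact Finset.sum_congr rfl fun l _ => by ring
  have hi (j l) := (hK j l).1.const_mul (a j * conj (a l))
  simp only [e]
  refine ⟨integrable_finsetSum _ fun j _ => integrable_finsetSum _ fun l _ => hi j l, ?_⟩
  rw [integral_finsetSum _ fun j _ => integrable_finsetSum _ fun l _ => hi j l]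
  simp only [integral_finsetSum _ fun l _ => hi _ l, integral_const_mul, (hK _ _).2]
  have : ((‖∑ j, a j • v j‖ ^ 2 : ℝ) : ℂ) = inner ℂ (∑ j, a j • v j) (∑ j, a j • v j) := by
    rw [inner_self_eq_norm_sq_to_K]; simp
  rw [this, sum_inner, Finset.mul_sum, Finset.sum_comm]
  refine Finset.sum_congr rfl fun l _ => ?_
  rw [inner_sum, Finset.mul_sum]
  refine Finset.sum_congr rfl fun j _ => ?_
  rw [inner_smul_left, inner_smul_right]
  ring

/-- Expansion of `0 ≤ ‖a - c * b‖ ^ 2`. -/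
lemma two_mul_re_mul_conj_le (a b : ℂ) (c : ℝ) :
    2 * c * (a * conj b).re - (a * conj a).re ≤ c ^ 2 * ‖b‖ ^ 2 := by
  have h : 0 ≤ Complex.normSq (a - c * b) := Complex.normSq_nonneg _
  rw [← Complex.normSq_eq_norm_sq]
  simp only [Complex.normSq_apply, Complex.mul_re, Complex.sub_re, Complex.sub_im, Complex.mul_im,
    Complex.ofReal_re, Complex.ofReal_im, Complex.conj_re, Complex.conj_im] at h ⊢
  nlinarith

/-- The complex little Grothendieck inequality. -/
theorem little_grothendieck {m n : ℕ} (X : Matrix (Fin m) (Fin n) ℂ)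
    (v : Fin n → EuclideanSpace ℂ ι) (hv : ∀ j, ‖v j‖ ≤ 1) :
    ∑ i, ‖∑ j, X i j • v j‖ ^ 2 ≤ 4 / Real.pi * normF X ^ 2 := by
  classical
  set Q : ℝ := ∑ i, ‖∑ j, X i j • v j‖ ^ 2 with hQ
  set κ : ℝ := √Real.pi / 2 with hκ
  have hκpos : 0 < κ := by positivity
  set N : ℝ := Real.pi ^ Fintype.card ι with hN
  have hNpos : 0 < N := by positivity
  -- `L x` applies `X` to Gaussian variables whose covariances are the inner products of the `v j`.
  -- `S x` applies it to their phases damped by `‖v l‖`, a point of the polydisc, so `‖S x‖ ≤ normF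
  -- X`.
  let L : (ι → ℂ) → Fin m → ℂ := fun x i => ∑ j, X i j * inner ℂ (WithLp.toLp 2 x) (v j)
  let K : Fin n → (ι → ℂ) → ℂ := fun l x => ‖v l‖ * phase (inner ℂ (v l) (WithLp.toLp 2 x))
  let S : (ι → ℂ) → Fin m → ℂ := fun x i => ∑ l, X i l * conj (K l x)
  have hA (i) := gauss_sum_mul_sum (X i) v (fun l x => inner ℂ (v l) (WithLp.toLp 2 x)) (N : ℂ)
    fun j l => by simpa [hN] using gauss_inner_mul_inner (v l) (v j)
  have hB (i) := gauss_sum_mul_sum (X i) v K (N * κ : ℂ) fun j l => by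
    simpa [hN, hκ, K, mul_assoc] using gauss_inner_mul_phase (v l) (v j)
  have eA (x i) : (∑ l, conj (X i l) * inner ℂ (v l) (WithLp.toLp 2 x)) = conj (L x i) := by
    simp [L]
  have eB (x i) : (∑ l, conj (X i l) * K l x) = conj (S x i) := by
    simp [S]
  simp only [eA] at hA
  simp only [eB] at hB
  -- The multiplier `κ⁻¹` is the optimal one: the cross term integrates to `2 * N * Q` and the
  -- square to `N * Q`, leaving `N * Q` on the left.
  have hpt (x : ι → ℂ) : (∑ i, (2 * κ⁻¹ * ((gaussWeight x : ℂ) * (L x i * conj (S x i))).re -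
      ((gaussWeight x : ℂ) * (L x i * conj (L x i))).re)) ≤
      κ⁻¹ ^ 2 * normF X ^ 2 * gaussWeight x := by
    have h1 : ∑ i, ‖S x i‖ ^ 2 ≤ normF X ^ 2 := by
      refine sum_norm_sq_le_normF X _ fun l => ?_
      simp only [K, RCLike.norm_conj, norm_mul, Complex.norm_real, norm_norm]
      exact mul_le_one₀ (hv l) (norm_nonneg _) (norm_phase_le _)
    calc _ = ∑ i, gaussWeight x * (2 * κ⁻¹ * (L x i * conj (S x i)).re
          - (L x i * conj (L x i)).re) := by
          refine Finset.sum_congr rfl fun i _ => ?_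
          rw [Complex.re_ofReal_mul, Complex.re_ofReal_mul]; ring
      _ ≤ ∑ i, gaussWeight x * (κ⁻¹ ^ 2 * ‖S x i‖ ^ 2) :=
          Finset.sum_le_sum fun i _ => mul_le_mul_of_nonneg_left
            (two_mul_re_mul_conj_le _ _ _) (gaussWeight_nonneg x)
      _ = gaussWeight x * κ⁻¹ ^ 2 * ∑ i, ‖S x i‖ ^ 2 := by
          rw [Finset.mul_sum]; exact Finset.sum_congr rfl fun i _ => by ring
      _ ≤ gaussWeight x * κ⁻¹ ^ 2 * normF X ^ 2 :=
          mul_le_mul_of_nonneg_left h1 (mul_nonneg (gaussWeight_nonneg x) (by positivity))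
      _ = _ := by ring
  have hiA (i) : Integrable fun x : ι → ℂ => ((gaussWeight x : ℂ) * (L x i * conj (L x i))).re :=
    (hA i).1.re
  have hiB (i) : Integrable fun x : ι → ℂ =>
      2 * κ⁻¹ * ((gaussWeight x : ℂ) * (L x i * conj (S x i))).re :=
    (hB i).1.re.const_mul _
  have hmono := integral_mono (integrable_finsetSum _ fun i _ => (hiB i).sub (hiA i))
    (integrable_gaussWeight.const_mul _) hpt
  rw [integral_const_mul, integral_gaussWeight, integral_finsetSum _ fun i _ =>
    (hiB i).sub (hiA i)] at hmono
  have hval (i) : ∫ x : ι → ℂ, (2 * κ⁻¹ * ((gaussWeight x : ℂ) * (L x i * conj (S x i))).re -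
      ((gaussWeight x : ℂ) * (L x i * conj (L x i))).re) = N * ‖∑ j, X i j • v j‖ ^ 2 := by
    have rA : ∫ x : ι → ℂ, ((gaussWeight x : ℂ) * (L x i * conj (L x i))).re =
        N * ‖∑ j, X i j • v j‖ ^ 2 := by
      refine (integral_re (hA i).1).trans ?_
      rw [(hA i).2, ← Complex.ofReal_mul]; rfl
    have rB : ∫ x : ι → ℂ, ((gaussWeight x : ℂ) * (L x i * conj (S x i))).re =
        N * κ * ‖∑ j, X i j • v j‖ ^ 2 := by
      refine (integral_re (hB i).1).trans ?_
      rw [(hB i).2, ← Complex.ofReal_mul, ← Complex.ofReal_mul]; rfl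
    rw [integral_sub (hiB i) (hiA i), integral_const_mul, rA, rB]
    field_simp
    ring
  replace hmono := (Finset.sum_congr rfl fun i _ => (hval i).symm).trans_le hmono
  rw [← Finset.mul_sum, ← hQ, mul_comm _ N] at hmono
  have h := le_of_mul_le_mul_left hmono hNpos
  have hκ2 : κ⁻¹ ^ 2 = 4 / Real.pi := by
    rw [hκ, inv_pow, div_pow, Real.sq_sqrt Real.pi_pos.le]; field_simp; norm_num
  rwa [hκ2] at h

end

/-! ### The completely bounded norm -/

open scoped Matrix.Norms.L2Operator

lemma FAmp_apply {m n : ℕ} (X : Matrix (Fin m) (Fin n) ℂ) (k : ℕ)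
    (a : Fin n → Matrix (Fin k) (Fin k) ℂ) (p : Fin m × Fin k) (q : Fin k) :
    FAmp X k a p q = ∑ j, X p.1 j * a j p.2 q := rfl

lemma FAmp_mulVec_norm_sq {m n : ℕ} (X : Matrix (Fin m) (Fin n) ℂ) (k : ℕ)
    (a : Fin n → Matrix (Fin k) (Fin k) ℂ) (ξ : EuclideanSpace ℂ (Fin k)) :
    ‖(WithLp.toLp 2 ((FAmp X k a).mulVec ξ) : EuclideanSpace ℂ (Fin m × Fin k))‖ ^ 2 =
      ∑ i, ‖∑ j, X i j • (WithLp.toLp 2 ((a j).mulVec ξ) : EuclideanSpace ℂ (Fin k))‖ ^ 2 := by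
  simp only [EuclideanSpace.norm_sq_eq]
  rw [Fintype.sum_prod_type]
  refine Finset.sum_congr rfl fun i _ => Finset.sum_congr rfl fun p _ => ?_
  congr 2
  simp only [Matrix.mulVec, dotProduct, FAmp_apply, WithLp.ofLp_sum, WithLp.ofLp_smul,
    Finset.sum_apply, Pi.smul_apply, smul_eq_mul, Finset.sum_mul, Finset.mul_sum]
  rw [Finset.sum_comm]
  exact Finset.sum_congr rfl fun _ _ => Finset.sum_congr rfl fun _ _ => by ring

lemma l2_opNorm_le_of_mulVec {k l : Type*} [Fintype k] [Fintype l] [DecidableEq l]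
    (A : Matrix k l ℂ) {C : ℝ} (hC : 0 ≤ C)
    (h : ∀ ξ : EuclideanSpace ℂ l,
      ‖(WithLp.toLp 2 (A.mulVec ξ) : EuclideanSpace ℂ k)‖ ≤ C * ‖ξ‖) : ‖A‖ ≤ C := by
  rw [Matrix.l2_opNorm_def]
  exact ContinuousLinearMap.opNorm_le_bound _ hC h

lemma norm_FAmp_le {m n : ℕ} (X : Matrix (Fin m) (Fin n) ℂ) (k : ℕ) :
    ‖FAmp X k‖ ≤ √(4 / Real.pi) * normF X := by
  have hC : 0 ≤ √(4 / Real.pi) * normF X := mul_nonneg (Real.sqrt_nonneg _) (normF_nonneg X)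
  -- On a vector `ξ`, the amplification is governed by the vectors `a j ξ / ‖ξ‖`, which lie in the
  -- unit ball.
  refine ContinuousLinearMap.opNorm_le_of_unit_norm hC fun a ha => ?_
  refine l2_opNorm_le_of_mulVec _ hC fun ξ => ?_
  by_cases hξ : ξ = 0
  · simp [hξ]
  have hξ' : 0 < ‖ξ‖ := norm_pos_iff.2 hξ
  have hv (j) : ‖((‖ξ‖ : ℂ)⁻¹ • (WithLp.toLp 2 ((a j).mulVec ξ) :
      EuclideanSpace ℂ (Fin k)))‖ ≤ 1 := by
    rw [norm_smul, norm_inv, Complex.norm_real, norm_norm, inv_mul_le_one₀ hξ']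
    refine (Matrix.l2_opNorm_mulVec (a j) ξ).trans (mul_le_of_le_one_left (norm_nonneg _) ?_)
    exact (norm_le_pi_norm a j).trans ha.le
  have h := little_grothendieck X _ hv
  simp only [smul_comm _ ((‖ξ‖ : ℂ)⁻¹), ← Finset.smul_sum, norm_smul, norm_inv, mul_pow,
    Complex.norm_real, norm_norm, ← Finset.mul_sum] at h
  rw [← FAmp_mulVec_norm_sq, inv_pow, inv_mul_le_iff₀ (by positivity)] at h
  refine le_of_sq_le_sq ?_ (mul_nonneg hC hξ'.le)
  rw [mul_pow, mul_pow, Real.sq_sqrt (by positivity)]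
  linarith

/-- Without this bound the supremum in `normCbF` could take its default value `0`. -/
lemma bddAbove_norm_FAmp {m n : ℕ} (X : Matrix (Fin m) (Fin n) ℂ) :
    BddAbove (Set.range fun k : ℕ => ‖FAmp X k‖) :=
  ⟨_, by rintro _ ⟨k, rfl⟩; exact norm_FAmp_le X k⟩

lemma four_div_pi_mem : (4 / Real.pi : ℝ) ∈ {c : ℝ | 0 < c ∧
    ∀ (m n : ℕ) (X : Matrix (Fin m) (Fin n) ℂ), normCbF X ≤ √c * normF X} :=
  ⟨by positivity, fun _ _ X => ciSup_le fun k => norm_FAmp_le X k⟩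

lemma bddBelow_littleGrothendieck : BddBelow {c : ℝ | 0 < c ∧
    ∀ (m n : ℕ) (X : Matrix (Fin m) (Fin n) ℂ), normCbF X ≤ √c * normF X} :=
  ⟨0, fun _ h => h.1.le⟩

lemma littleGrothendieckConst_nonneg : 0 ≤ littleGrothendieckConst :=
  Real.sInf_nonneg fun _ h => h.1.le

lemma littleGrothendieckConst_lt_two : littleGrothendieckConst < 2 := by
  refine (csInf_le bddBelow_littleGrothendieck four_div_pi_mem).trans_lt ?_
  rw [div_lt_iff₀ Real.pi_pos]
  linarith [Real.pi_gt_three]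

/-- The admissible constants satisfy a condition closed in `c`, so it passes to their infimum. -/
lemma normCbF_le {m n : ℕ} (X : Matrix (Fin m) (Fin n) ℂ) :
    normCbF X ≤ √littleGrothendieckConst * normF X := by
  have h1 := csInf_mem_closure ⟨_, four_div_pi_mem⟩ bddBelow_littleGrothendieck
  have h2 : IsClosed {c : ℝ | normCbF X ≤ √c * normF X} :=
    isClosed_le continuous_const (by fun_prop)
  exact closure_minimal (fun c hc => hc.2 m n X) h2 h1

/-- The vectors `v j` are encoded as the first columns of matrices `a j` of norm at most one, and
the amplification is tested on the first basis vector. Dimension zero is separate because it has no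
first column. -/
lemma sum_norm_sq_le_const_mul_normF {m n N : ℕ} (X : Matrix (Fin m) (Fin n) ℂ)
    (v : Fin n → EuclideanSpace ℂ (Fin N)) (hv : ∀ j, ‖v j‖ ≤ 1) :
    ∑ i, ‖∑ j, X i j • v j‖ ^ 2 ≤ littleGrothendieckConst * normF X ^ 2 := by
  have hk := littleGrothendieckConst_nonneg
  obtain _ | N := N
  · simp only [EuclideanSpace.norm_sq_eq, Finset.univ_eq_empty, Finset.sum_empty,
      Finset.sum_const_zero]
    exact mul_nonneg hk (sq_nonneg _)
  let a : Fin n → Matrix (Fin (N + 1)) (Fin (N + 1)) ℂ := fun j =>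
    Matrix.of fun p q => if q = 0 then v j p else 0
  have ha (j) (ξ : EuclideanSpace ℂ (Fin (N + 1))) :
      (WithLp.toLp 2 ((a j).mulVec ξ) : EuclideanSpace ℂ (Fin (N + 1))) = ξ 0 • v j := by
    ext p
    simp [a, Matrix.mulVec, dotProduct, mul_comm]
  have hnorm : ‖a‖ ≤ 1 := by
    refine (pi_norm_le_iff_of_nonneg zero_le_one).2 fun j => ?_
    refine l2_opNorm_le_of_mulVec _ zero_le_one fun ξ => ?_
    rw [ha, norm_smul, one_mul]
    exact (mul_le_of_le_one_right (norm_nonneg _) (hv j)).trans (PiLp.norm_apply_le ξ 0)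
  let ξ : EuclideanSpace ℂ (Fin (N + 1)) := EuclideanSpace.single 0 1
  have h1 : ‖(WithLp.toLp 2 ((FAmp X (N + 1) a).mulVec ξ) :
      EuclideanSpace ℂ (Fin m × Fin (N + 1)))‖ ≤ √littleGrothendieckConst * normF X := by
    refine (Matrix.l2_opNorm_mulVec _ ξ).trans ?_
    have e : ‖ξ‖ = 1 := by simp [ξ]
    rw [e, mul_one]
    calc ‖FAmp X (N + 1) a‖ ≤ ‖FAmp X (N + 1)‖ * ‖a‖ := ContinuousLinearMap.le_opNorm _ _
      _ ≤ ‖FAmp X (N + 1)‖ := mul_le_of_le_one_right (norm_nonneg (FAmp X (N + 1))) hnorm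
      _ ≤ normCbF X := le_ciSup (bddAbove_norm_FAmp X) (N + 1)
      _ ≤ _ := normCbF_le X
  have h2 := pow_le_pow_left₀ (norm_nonneg _) h1 2
  rw [FAmp_mulVec_norm_sq, mul_pow, Real.sq_sqrt hk] at h2
  simpa only [ha, ξ, PiLp.single_apply, if_true, one_smul] using h2

end Grothendieck

namespace Grothendieck

open ComplexConjugate ComplexOrder Matrix

/-! ### Positive semidefinite matrices and real functionals on matrices -/

section Psd

variable {μ ν : Type*}

instance locallyConvexSpace_matrix : LocallyConvexSpace ℝ (Matrix μ ν ℂ) :=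
  inferInstanceAs (LocallyConvexSpace ℝ (μ → ν → ℂ))

lemma isCompact_of_norm_entry_le {S : Set (Matrix μ ν ℂ)} (hS : IsClosed S) (r : ℝ)
    (h : ∀ M ∈ S, ∀ i j, ‖M i j‖ ≤ r) : IsCompact S := by
  have hK : IsCompact (Set.pi Set.univ fun _ : μ => Set.pi Set.univ fun _ : ν =>
      Metric.closedBall (0 : ℂ) r) :=
    isCompact_univ_pi fun _ => isCompact_univ_pi fun _ => isCompact_closedBall 0 r
  refine IsCompact.of_isClosed_subset hK hS fun M hM i _ j _ => ?_
  simpa using h M hM i j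

lemma convex_setOf_posSemidef : Convex ℝ {M : Matrix μ μ ℂ | M.PosSemidef} := by
  intro A hA B hB a b ha hb _
  exact (PosSemidef.smul hA ha).add (PosSemidef.smul hB hb)

variable [Fintype μ]

lemma exists_eq_sum_re_mul [Fintype ν] (f : Matrix μ ν ℂ →ₗ[ℝ] ℝ) :
    ∃ Y : Matrix μ ν ℂ, ∀ Z, f Z = ∑ i, ∑ j, (Z i j * Y i j).re := by
  classical
  -- The pairing has no conjugation: `Re ((x + iy) Y) = x Re Y - y Im Y`, whence the minus sign.
  refine ⟨Matrix.of fun i j => ⟨f (Matrix.single i j 1), - f (Matrix.single i j Complex.I)⟩,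
    fun Z => ?_⟩
  conv_lhs => rw [Matrix.matrix_eq_sum_single Z]
  simp only [map_sum]
  refine Finset.sum_congr rfl fun i _ => Finset.sum_congr rfl fun j _ => ?_
  have : Matrix.single i j (Z i j) =
      (Z i j).re • Matrix.single i j (1 : ℂ) + (Z i j).im • Matrix.single i j Complex.I := by
    rw [Matrix.smul_single, Matrix.smul_single, ← Matrix.single_add]
    congr 1
    apply Complex.ext <;> simp
  rw [this, map_add, map_smul, map_smul]
  simp [Complex.mul_re]

lemma isClosed_setOf_posSemidef : IsClosed {M : Matrix μ μ ℂ | M.PosSemidef} := by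
  have : {M : Matrix μ μ ℂ | M.PosSemidef} = {M | Mᴴ = M} ∩
      ⋂ x : μ → ℂ, {M | 0 ≤ star x ⬝ᵥ M *ᵥ x} := by
    ext M
    simp only [Set.mem_ofPred_eq, Set.mem_inter_iff, Set.mem_iInter,
      posSemidef_iff_dotProduct_mulVec]
    rfl
  rw [this]
  refine (isClosed_eq (by fun_prop) continuous_id).inter (isClosed_iInter fun x => ?_)
  exact isClosed_le continuous_const (by fun_prop)

lemma posSemidef_exists_gram {M : Matrix μ μ ℂ} (hM : M.PosSemidef) :
    ∃ (r : ℕ) (v : μ → EuclideanSpace ℂ (Fin r)), ∀ i j, M i j = inner ℂ (v j) (v i) := by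
  obtain ⟨r, w, rfl⟩ := posSemidef_iff_eq_sum_vecMulVec.1 hM
  refine ⟨r, fun i => WithLp.toLp 2 fun p => w p i, fun i j => ?_⟩
  simp [Matrix.sum_apply, vecMulVec_apply, PiLp.inner_apply]

lemma posSemidef_norm_entry_le {M : Matrix μ μ ℂ} (hM : M.PosSemidef) {a b : ℝ} {i j : μ}
    (ha : (M i i).re ≤ a ^ 2) (hb : (M j j).re ≤ b ^ 2) (ha0 : 0 ≤ a) (hb0 : 0 ≤ b) :
    ‖M i j‖ ≤ a * b := by
  obtain ⟨r, v, hv⟩ := posSemidef_exists_gram hM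
  have e (l : μ) : (M l l).re = ‖v l‖ ^ 2 := by
    rw [hv]; exact inner_self_eq_norm_sq (𝕜 := ℂ) (v l)
  rw [e] at ha hb
  rw [hv, mul_comm]
  exact (norm_inner_le_norm _ _).trans (mul_le_mul (le_of_sq_le_sq hb hb0)
    (le_of_sq_le_sq ha ha0) (norm_nonneg _) hb0)

/-- A real functional which is nonnegative on the rank one positive matrices is given by a
sum of squares there. -/
lemma exists_eq_sum_norm_sq (f : Matrix μ μ ℂ →ₗ[ℝ] ℝ)
    (hf : ∀ b : μ → ℂ, 0 ≤ f (vecMulVec b (star b))) :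
    ∃ (q : ℕ) (X : Matrix (Fin q) μ ℂ), ∀ b : μ → ℂ,
      f (vecMulVec b (star b)) = ∑ i, ‖∑ j, X i j * b j‖ ^ 2 := by
  obtain ⟨Y, hY⟩ := exists_eq_sum_re_mul f
  -- The Hermitian part of the transpose of `Y`, so that `b* H b` equals `f (b b*)`.
  let H : Matrix μ μ ℂ := Matrix.of fun j i => (Y i j + conj (Y j i)) / 2
  have hH (b : μ → ℂ) : star b ⬝ᵥ H *ᵥ b = (f (vecMulVec b (star b)) : ℂ) := by
    have e (z : ℂ) : (z.re : ℂ) = (z + conj z) / 2 := by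
      rw [Complex.add_conj]; push_cast; ring
    rw [hY]
    push_cast
    simp only [e, vecMulVec_apply, Pi.star_apply, map_mul, RCLike.star_def, Complex.conj_conj,
      ← Finset.sum_div, Finset.sum_add_distrib]
    simp only [H, dotProduct, mulVec, Matrix.of_apply, Pi.star_apply, RCLike.star_def,
      Finset.mul_sum]
    rw [eq_div_iff two_ne_zero]
    rw [Finset.sum_comm (f := fun i j => b i * conj (b j) * Y i j), ← Finset.sum_add_distrib,
      Finset.sum_mul]
    refine Finset.sum_congr rfl fun i _ => ?_
    rw [← Finset.sum_add_distrib, Finset.sum_mul]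
    refine Finset.sum_congr rfl fun j _ => ?_
    ring
  have hpsd : H.PosSemidef := by
    refine PosSemidef.of_dotProduct_mulVec_nonneg ?_ fun b => ?_
    · ext i j
      simp [H, add_comm]
    · rw [hH]
      exact_mod_cast hf b
  obtain ⟨r, v, hv⟩ := posSemidef_iff_eq_sum_vecMulVec.1 hpsd
  refine ⟨r, Matrix.of fun p j => conj (v p j), fun b => ?_⟩
  have h := hH b
  rw [hv] at h
  apply Complex.ofReal_injective
  rw [← h, Matrix.sum_mulVec, dotProduct_sum]
  push_cast
  refine Finset.sum_congr rfl fun p _ => ?_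
  have e1 : star (v p) ⬝ᵥ b = ∑ j, conj (v p j) * b j := rfl
  have e2 : star b ⬝ᵥ v p = conj (star (v p) ⬝ᵥ b) := by
    simp [dotProduct, mul_comm]
  rw [vecMulVec_mulVec, dotProduct_smul, e2, e1]
  simp only [Matrix.of_apply]
  rw [op_smul_eq_mul, ← Complex.normSq_eq_conj_mul_self, Complex.normSq_eq_norm_sq,
    Complex.ofReal_pow]

end Psd

/-! ### Duality -/

/-- The closed convex hull of the matrices `a a*` with `a` in the closed unit polydisc. -/
def polydiscHull (μ : Type*) : Set (Matrix μ μ ℂ) :=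
  closure (convexHull ℝ {A | ∃ a : μ → ℂ, (∀ i, ‖a i‖ ≤ 1) ∧ A = vecMulVec a (star a)})

lemma norm_entry_le_of_mem_polydiscHull {μ : Type*} {A : Matrix μ μ ℂ}
    (hA : A ∈ polydiscHull μ) (i j : μ) : ‖A i j‖ ≤ 1 := by
  have hc : IsClosed {A : Matrix μ μ ℂ | ‖A i j‖ ≤ 1} :=
    isClosed_le (by fun_prop) continuous_const
  have hconv : Convex ℝ {A : Matrix μ μ ℂ | ‖A i j‖ ≤ 1} := by
    intro A hA B hB a b ha hb hab
    have := (convex_closedBall (0 : ℂ) 1) (x := A i j) (by simpa using hA) (y := B i j)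
      (by simpa using hB) ha hb hab
    simpa using this
  refine closure_minimal (convexHull_min ?_ hconv) hc hA
  rintro _ ⟨a, ha, rfl⟩
  simpa [vecMulVec_apply] using mul_le_one₀ (ha i) (norm_nonneg _) (ha j)

lemma isCompact_polydiscHull {μ : Type*} [Fintype μ] : IsCompact (polydiscHull μ) :=
  isCompact_of_norm_entry_le isClosed_closure 1 fun _ hA => norm_entry_le_of_mem_polydiscHull hA

/-- Dual form of the little Grothendieck inequality. -/
theorem exists_polydiscHull_sub_posSemidef {N : ℕ} {C : Matrix (Fin N) (Fin N) ℂ}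
    (hC : C.PosSemidef) (hdiag : ∀ i, (C i i).re ≤ 1) :
    ∃ A ∈ polydiscHull (Fin N), (littleGrothendieckConst • A - C).PosSemidef := by
  by_contra! hcon
  set k := littleGrothendieckConst with hk
  have hk0 : 0 ≤ k := littleGrothendieckConst_nonneg
  have hconv : Convex ℝ (polydiscHull (Fin N)) := (convex_convexHull ℝ _).closure
  let g : Matrix (Fin N) (Fin N) ℂ → Matrix (Fin N) (Fin N) ℂ := fun A => k • A - C
  have hg : Continuous g := by fun_prop
  -- A separating `f` is nonnegative on the positive cone, hence a sum of squares given by some `X`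
  -- on matrices `a a*`. The polydisc gives `k * normF X ^ 2 ≤ f C + u`, the inequality for `X`
  -- gives `f C ≤ k * normF X ^ 2`, and `u < v < 0` is contradicted.
  obtain ⟨f, u, v, h1, huv, h2⟩ := geometric_hahn_banach_compact_closed
    (s := g '' polydiscHull (Fin N)) (t := {M | M.PosSemidef})
    (by
      rintro _ ⟨A, hA, rfl⟩ _ ⟨B, hB, rfl⟩ a b ha hb hab
      refine ⟨a • A + b • B, hconv hA hB ha hb hab, ?_⟩
      have : C = a • C + b • C := by rw [← add_smul, hab, one_smul]
      simp only [g]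
      conv_lhs => rw [this]
      module)
    (isCompact_polydiscHull.image hg) convex_setOf_posSemidef isClosed_setOf_posSemidef
    (by
      rw [Set.disjoint_left]
      rintro _ ⟨A, hA, rfl⟩ hp
      exact hcon A hA hp)
  have hv : v < 0 := by simpa using h2 0 PosSemidef.zero
  have hpos (M : Matrix (Fin N) (Fin N) ℂ) (hM : M.PosSemidef) : 0 ≤ f M := by
    by_contra! hneg
    have := h2 ((v / f M) • M) (PosSemidef.smul hM (div_pos_of_neg_of_neg hv hneg).le)
    rw [map_smul, smul_eq_mul, div_mul_cancel₀ _ hneg.ne] at this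
    exact lt_irrefl _ this
  obtain ⟨q, X, hX⟩ := exists_eq_sum_norm_sq f.toLinearMap
    fun b => hpos _ (posSemidef_vecMulVec_self_star b)
  simp only [ContinuousLinearMap.coe_coe] at hX
  have hball (a : Fin N → ℂ) (ha : ∀ i, ‖a i‖ ≤ 1) : k * ‖FMap X a‖ ^ 2 ≤ f C + u := by
    have := h1 _ ⟨_, subset_closure (subset_convexHull ℝ _ ⟨a, ha, rfl⟩), rfl⟩
    simp only [g, map_sub, map_smul, hX, smul_eq_mul] at this
    rw [EuclideanSpace.norm_sq_eq]
    simp only [FMap_apply]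
    linarith
  have ht : 0 ≤ f C + u := by simpa using hball 0 (by simp)
  have hF : k * normF X ^ 2 ≤ f C + u := by
    rcases hk0.eq_or_lt with h0 | hkpos
    · rw [← h0, zero_mul]; exact ht
    have : normF X ≤ √((f C + u) / k) := by
      refine ContinuousLinearMap.opNorm_le_of_unit_norm (Real.sqrt_nonneg _) fun a ha => ?_
      refine Real.le_sqrt_of_sq_le ?_
      rw [le_div_iff₀ hkpos, mul_comm]
      exact hball a fun i => (norm_le_pi_norm a i).trans ha.le
    have := pow_le_pow_left₀ (normF_nonneg X) this 2
    rw [Real.sq_sqrt (by positivity), le_div_iff₀ hkpos] at this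
    linarith
  -- The entries of the `w p` at `j` form a Gram vector of squared norm `C j j ≤ 1`.
  obtain ⟨r, w, hw⟩ := posSemidef_iff_eq_sum_vecMulVec.1 hC
  have hCle : f C ≤ k * normF X ^ 2 := by
    have := sum_norm_sq_le_const_mul_normF X
      (fun j => (WithLp.toLp 2 fun p => w p j : EuclideanSpace ℂ (Fin r))) fun j => by
        have h := hdiag j
        rw [← sq_le_one_iff₀ (norm_nonneg _), EuclideanSpace.norm_sq_eq]
        refine le_trans (le_of_eq ?_) h
        rw [hw, Matrix.sum_apply, Complex.re_sum]
        refine Finset.sum_congr rfl fun p _ => ?_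
        rw [vecMulVec_apply, Pi.star_apply, RCLike.star_def, Complex.mul_conj,
          Complex.normSq_eq_norm_sq, Complex.ofReal_re]
    refine le_trans (le_of_eq ?_) this
    rw [hw, map_sum]
    simp only [hX, EuclideanSpace.norm_sq_eq]
    rw [Finset.sum_comm]
    simp
  linarith

lemma one_le_littleGrothendieckConst : 1 ≤ littleGrothendieckConst := by
  obtain ⟨A, hA, hp⟩ := exists_polydiscHull_sub_posSemidef (N := 1) (C := 1)
    PosSemidef.one (by simp)
  have h1 := hp.diag_nonneg (i := 0)
  have h2 := (Complex.re_le_norm _).trans (norm_entry_le_of_mem_polydiscHull hA 0 0)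
  have h3 := (Complex.le_def.1 h1).1
  simp at h3
  nlinarith [littleGrothendieckConst_nonneg]

end Grothendieck

namespace Grothendieck

open ComplexConjugate ComplexOrder Matrix

/-! ### Factorisation of Schur multipliers -/

open scoped Matrix.Norms.L2Operator in
lemma norm_hadamard_le {m n : ℕ} (X A : Matrix (Fin m) (Fin n) ℂ) :
    ‖X ⊙ A‖ ≤ schurNorm X * ‖A‖ :=
  (schurMap X).le_opNorm A

open scoped Matrix.Norms.L2Operator in
/-- A Schur multiplier of norm at most one is controlled by every form `Y` dominated by diagonal
weights. -/
lemma schur_pairing_nonneg {m n : ℕ} {X : Matrix (Fin m) (Fin n) ℂ} (hX : schurNorm X ≤ 1)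
    (Y : Matrix (Fin m) (Fin n) ℂ) (w : Fin m → ℝ) (z : Fin n → ℝ) (hw : ∀ i, 0 < w i)
    (hz : ∀ j, 0 < z j)
    (hY : ∀ (a : Fin m → ℂ) (c : Fin n → ℂ), 0 ≤ (∑ i, ∑ j, (a i * c j * Y i j).re) +
      (∑ i, w i * ‖a i‖ ^ 2 + ∑ j, z j * ‖c j‖ ^ 2)) :
    0 ≤ (∑ i, ∑ j, (X i j * Y i j).re) + (∑ i, w i + ∑ j, z j) := by
  have hw' (i) : ((√(w i) : ℝ) : ℂ) ≠ 0 := by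
    simpa using (Real.sqrt_pos.2 (hw i)).ne'
  have hz' (j) : ((√(z j) : ℝ) : ℂ) ≠ 0 := by
    simpa using (Real.sqrt_pos.2 (hz j)).ne'
  -- Rescaling by the weights turns the domination of `Y` into an operator norm bound. The constant
  -- is `2` because `2 * ‖α‖ * ‖β‖ ≤ ‖α‖ ^ 2 + ‖β‖ ^ 2` is used at the end.
  let A : Matrix (Fin m) (Fin n) ℂ :=
    Matrix.of fun i j => (√(w i) : ℂ)⁻¹ * (√(z j) : ℂ)⁻¹ * Y i j
  have hA : ‖A‖ ≤ 2 := by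
    refine l2_opNorm_le_of_mulVec A zero_le_two fun ξ => ?_
    set η : EuclideanSpace ℂ (Fin m) := WithLp.toLp 2 (A *ᵥ ξ) with hη
    have hηi (i) : η i = ∑ j, A i j * ξ j := rfl
    -- The factor `-1 / 2` is the best multiple: it yields `‖η‖ ^ 2 / 4 ≤ ‖ξ‖ ^ 2`.
    have h := hY (fun i => (√(w i) : ℂ)⁻¹ * (-(conj (η i)) / 2))
      (fun j => (√(z j) : ℂ)⁻¹ * ξ j)
    have e1 : (∑ i, ∑ j, ((√(w i) : ℂ)⁻¹ * (-(conj (η i)) / 2) * ((√(z j) : ℂ)⁻¹ * ξ j) *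
        Y i j).re) = -(‖η‖ ^ 2 / 2) := by
      rw [EuclideanSpace.norm_sq_eq, Finset.sum_div, ← Finset.sum_neg_distrib]
      refine Finset.sum_congr rfl fun i _ => ?_
      rw [← Complex.re_sum]
      have : (∑ j, (√(w i) : ℂ)⁻¹ * (-(conj (η i)) / 2) * ((√(z j) : ℂ)⁻¹ * ξ j) * Y i j) =
          ((-(‖η i‖ ^ 2 / 2) : ℝ) : ℂ) := by
        have : ∀ j, (√(w i) : ℂ)⁻¹ * (-(conj (η i)) / 2) * ((√(z j) : ℂ)⁻¹ * ξ j) * Y i j =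
            (-(conj (η i)) / 2) * (A i j * ξ j) := fun j => by
          simp only [A, Matrix.of_apply]; ring
        simp only [this]
        rw [← Finset.mul_sum, ← hηi, ← Complex.normSq_eq_norm_sq]
        push_cast
        rw [Complex.normSq_eq_conj_mul_self]
        ring
      rw [this, Complex.ofReal_re]
    have e2 : ∑ i, w i * ‖(√(w i) : ℂ)⁻¹ * (-(conj (η i)) / 2)‖ ^ 2 = ‖η‖ ^ 2 / 4 := by
      rw [EuclideanSpace.norm_sq_eq, Finset.sum_div]
      refine Finset.sum_congr rfl fun i _ => ?_
      have := (hw i).ne'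
      rw [norm_mul, norm_inv, Complex.norm_real, Real.norm_of_nonneg (Real.sqrt_nonneg _),
        norm_div, norm_neg, RCLike.norm_conj, mul_pow, inv_pow, Real.sq_sqrt (hw i).le,
        mul_inv_cancel_left₀ this, div_pow]
      norm_num
    have e3 : ∑ j, z j * ‖(√(z j) : ℂ)⁻¹ * ξ j‖ ^ 2 = ‖ξ‖ ^ 2 := by
      rw [EuclideanSpace.norm_sq_eq]
      refine Finset.sum_congr rfl fun j _ => ?_
      have := (hz j).ne'
      rw [norm_mul, norm_inv, Complex.norm_real, Real.norm_of_nonneg (Real.sqrt_nonneg _),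
        mul_pow, inv_pow, Real.sq_sqrt (hz j).le, mul_inv_cancel_left₀ this]
    rw [e1, e2, e3] at h
    refine le_of_sq_le_sq ?_ (by positivity)
    linarith
  have hXA : ‖X ⊙ A‖ ≤ 2 := (norm_hadamard_le X A).trans
    ((mul_le_mul hX hA (norm_nonneg _) zero_le_one).trans (by norm_num))
  let α : EuclideanSpace ℂ (Fin m) := WithLp.toLp 2 fun i => (√(w i) : ℂ)
  let β : EuclideanSpace ℂ (Fin n) := WithLp.toLp 2 fun j => (√(z j) : ℂ)
  have hα : ‖α‖ ^ 2 = ∑ i, w i := by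
    rw [EuclideanSpace.norm_sq_eq]
    refine Finset.sum_congr rfl fun i _ => ?_
    simp [α, Real.sq_sqrt (hw i).le]
  have hβ : ‖β‖ ^ 2 = ∑ j, z j := by
    rw [EuclideanSpace.norm_sq_eq]
    refine Finset.sum_congr rfl fun j _ => ?_
    simp [β, Real.sq_sqrt (hz j).le]
  let γ : EuclideanSpace ℂ (Fin m) := WithLp.toLp 2 ((X ⊙ A) *ᵥ β)
  have hγ : ‖γ‖ ≤ 2 * ‖β‖ :=
    (Matrix.l2_opNorm_mulVec _ β).trans (mul_le_mul_of_nonneg_right hXA (norm_nonneg _))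
  have hsum : (∑ i, ∑ j, (X i j * Y i j).re) = (inner ℂ α γ).re := by
    rw [PiLp.inner_apply, Complex.re_sum]
    refine Finset.sum_congr rfl fun i _ => ?_
    rw [← Complex.re_sum]
    congr 1
    simp only [α, β, γ, mulVec, dotProduct, RCLike.inner_apply, Complex.conj_ofReal,
      hadamard_apply, A, Matrix.of_apply, Finset.sum_mul]
    refine Finset.sum_congr rfl fun j _ => ?_
    have := hw' i
    have := hz' j
    field_simp
  have h1 : |(inner ℂ α γ).re| ≤ ‖α‖ * (2 * ‖β‖) :=
    (Complex.abs_re_le_norm _).trans ((norm_inner_le_norm _ _).trans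
      (mul_le_mul_of_nonneg_left hγ (norm_nonneg _)))
  rw [hsum, ← hα, ← hβ]
  nlinarith [neg_abs_le (inner ℂ α γ).re, sq_nonneg (‖α‖ - ‖β‖)]

/-- The positive matrices with diagonal weights of total mass one. -/
def psdBase (μ : Type*) [Fintype μ] : Set (Matrix μ μ ℂ × (μ → ℝ)) :=
  {p | p.1.PosSemidef ∧ (∀ i, (p.1 i i).re ≤ p.2 i) ∧ ∑ i, p.2 i = 1}

section

variable {μ : Type*}

lemma re_diag_nonneg {M : Matrix μ μ ℂ} (hM : M.PosSemidef) (i : μ) : 0 ≤ (M i i).re :=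
  (Complex.le_def.1 (hM.diag_nonneg (i := i))).1

variable [Fintype μ]

lemma isCompact_psdBase : IsCompact (psdBase μ) := by
  have hcl : IsClosed (psdBase μ) := by
    refine (isClosed_setOf_posSemidef.preimage continuous_fst).inter (IsClosed.inter ?_ ?_)
    · have : {p : Matrix μ μ ℂ × (μ → ℝ) | ∀ i, (p.1 i i).re ≤ p.2 i} =
          ⋂ i, {p | (p.1 i i).re ≤ p.2 i} := Set.ofPred_forall _
      change IsClosed {p : Matrix μ μ ℂ × (μ → ℝ) | ∀ i, (p.1 i i).re ≤ p.2 i}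
      rw [this]
      exact isClosed_iInter fun i => isClosed_le (by fun_prop) (by fun_prop)
    · exact isClosed_eq (by fun_prop) continuous_const
  have h1 : IsCompact {M : Matrix μ μ ℂ | M ∈ {M : Matrix μ μ ℂ | ∀ i j, ‖M i j‖ ≤ 1}} := by
    refine isCompact_of_norm_entry_le ?_ 1 fun M hM => hM
    simp only [Set.ofPred_forall]
    exact isClosed_iInter fun i => isClosed_iInter fun j =>
      isClosed_le (by fun_prop) continuous_const
  refine IsCompact.of_isClosed_subset (h1.prod (isCompact_Icc (a := (0 : μ → ℝ)) (b := 1)))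
    hcl ?_
  rintro ⟨M, δ⟩ ⟨hM, hd, hs⟩
  have h0 (i) : 0 ≤ δ i := (re_diag_nonneg hM i).trans (hd i)
  have h1 (i) : δ i ≤ 1 := hs ▸ Finset.single_le_sum (fun j _ => h0 j) (Finset.mem_univ i)
  refine ⟨fun i j => ?_, fun i => h0 i, fun i => h1 i⟩
  have hb (i) : (M i i).re ≤ 1 ^ 2 := by simpa using (hd i).trans (h1 i)
  simpa using posSemidef_norm_entry_le hM (hb i) (hb j) zero_le_one zero_le_one

lemma convex_psdBase : Convex ℝ (psdBase μ) := by
  rintro ⟨A, δ⟩ ⟨hA, hd, hs⟩ ⟨B, δ'⟩ ⟨hB, hd', hs'⟩ a b ha hb hab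
  refine ⟨convex_setOf_posSemidef hA hB ha hb hab, fun i => ?_, ?_⟩
  · have := add_le_add (mul_le_mul_of_nonneg_left (hd i) ha) (mul_le_mul_of_nonneg_left (hd' i) hb)
    simpa using this
  · simp only [Prod.snd_add, Prod.smul_snd, Pi.add_apply, Pi.smul_apply, smul_eq_mul,
      Finset.sum_add_distrib, ← Finset.mul_sum]
    simp only at hs hs'
    rw [hs, hs', mul_one, mul_one, hab]

end

/-- A Schur multiplier of norm at most one is the off-diagonal block of a positive matrix with
diagonal at most one. -/
theorem exists_posSemidef_block {m n : ℕ} (hm : 0 < m) {X : Matrix (Fin m) (Fin n) ℂ}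
    (hX : schurNorm X ≤ 1) :
    ∃ M : Matrix (Fin m ⊕ Fin n) (Fin m ⊕ Fin n) ℂ, M.PosSemidef ∧ (∀ i, (M i i).re ≤ 1) ∧
      M.toBlocks₁₂ = X := by
  by_contra! hcon
  let E := Matrix (Fin m) (Fin n) ℂ × (Fin m ⊕ Fin n → ℝ)
  let φ : Matrix (Fin m ⊕ Fin n) (Fin m ⊕ Fin n) ℂ × (Fin m ⊕ Fin n → ℝ) →ₗ[ℝ] E :=
    { toFun := fun p => (p.1.toBlocks₁₂, p.2)
      map_add' := fun _ _ => rfl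
      map_smul' := fun _ _ => rfl }
  have hφ : Continuous φ := by
    refine Continuous.prodMk ?_ continuous_snd
    exact continuous_pi fun i => continuous_pi fun j => by
      show Continuous fun p : Matrix (Fin m ⊕ Fin n) (Fin m ⊕ Fin n) ℂ × (Fin m ⊕ Fin n → ℝ) =>
        p.1 (Sum.inl i) (Sum.inr j)
      fun_prop
  let p₀ : E := (X, fun _ => 1)
  have hp₀ : p₀ ≠ 0 := fun h => one_ne_zero (congrFun (congrArg Prod.snd h) (Sum.inl ⟨0, hm⟩))
  -- Normalising the total weight makes the first set compact. The ray through `(X, 1)` meets it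
  -- only at some `t > 0`, and dividing by `t` would produce the desired positive matrix.
  obtain ⟨f, u, v, h1, huv, h2⟩ := geometric_hahn_banach_compact_closed
    (s := φ '' psdBase (Fin m ⊕ Fin n)) (t := (fun t : ℝ => t • p₀) '' Set.Ici 0)
    (convex_psdBase.linear_image φ) (isCompact_psdBase.image hφ)
    (by
      exact (convex_Ici (0 : ℝ)).linear_image (LinearMap.toSpanSingleton ℝ E p₀))
    ((isClosedEmbedding_smul_left hp₀).isClosedMap _ isClosed_Ici)
    (by
      rw [Set.disjoint_left]
      rintro _ ⟨⟨M, δ⟩, ⟨hM, hd, hs⟩, rfl⟩ ⟨t, ht, hpt⟩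
      have e1 : t • X = M.toBlocks₁₂ := congrArg Prod.fst hpt
      have e2 (i) : t = δ i := by
        have h : t * 1 = δ i := congrFun (congrArg Prod.snd hpt) i
        rwa [mul_one] at h
      have htpos : 0 < t := by
        refine lt_of_le_of_ne ht fun h0 => ?_
        have : ∑ i, δ i = 0 := Finset.sum_eq_zero fun i _ => by rw [← e2, h0]
        exact one_ne_zero (hs.symm.trans this)
      refine hcon (t⁻¹ • M) (PosSemidef.smul hM (inv_nonneg.2 ht)) (fun i => ?_) ?_
      · rw [Matrix.smul_apply, Complex.smul_re, smul_eq_mul, inv_mul_le_one₀ htpos]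
        exact (hd i).trans_eq (e2 i).symm
      · have : (t⁻¹ • M).toBlocks₁₂ = t⁻¹ • M.toBlocks₁₂ := rfl
        rw [this, ← e1, smul_smul, inv_mul_cancel₀ htpos.ne', one_smul])
  have hv : v < 0 := by simpa using h2 0 ⟨0, by simp, by simp⟩
  have hp : 0 ≤ f p₀ := by
    by_contra! hneg
    have := h2 ((v / f p₀) • p₀) ⟨_, (div_pos_of_neg_of_neg hv hneg).le, rfl⟩
    rw [map_smul, smul_eq_mul, div_mul_cancel₀ _ hneg.ne] at this
    exact lt_irrefl _ this
  set ε : ℝ := -u with hε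
  have hεpos : 0 < ε := by linarith
  obtain ⟨Y, hY⟩ := exists_eq_sum_re_mul
    (-(f.toLinearMap ∘ₗ LinearMap.inl ℝ (Matrix (Fin m) (Fin n) ℂ) (Fin m ⊕ Fin n → ℝ)))
  let W : Fin m ⊕ Fin n → ℝ := fun i => -f (0, Pi.single i 1)
  have hf (Z : Matrix (Fin m) (Fin n) ℂ) (δ : Fin m ⊕ Fin n → ℝ) :
      -f (Z, δ) = (∑ i, ∑ j, (Z i j * Y i j).re) + ∑ i, W i * δ i := by
    rw [← hY]
    have e : δ = ∑ i, δ i • (Pi.single i 1 : Fin m ⊕ Fin n → ℝ) := by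
      ext j
      simp [Finset.sum_apply, Pi.single_apply]
    have e2 : -f (0, δ) = ∑ i, W i * δ i := by
      have : ((0, δ) : E) = ∑ i, δ i • ((0, Pi.single i 1) : E) := by
        refine Prod.ext ?_ ?_
        · simp [Prod.fst_sum]
        · simpa [Prod.snd_sum] using e
      rw [this, map_sum, ← Finset.sum_neg_distrib]
      refine Finset.sum_congr rfl fun i _ => ?_
      rw [map_smul, smul_eq_mul]
      simp only [W]
      ring
    rw [← e2]
    have : ((Z, δ) : E) = (Z, 0) + (0, δ) := by simp
    rw [this, map_add, neg_add]
    rfl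
  have hdom (M : Matrix (Fin m ⊕ Fin n) (Fin m ⊕ Fin n) ℂ) (hM : M.PosSemidef) :
      ε * ∑ i, (M i i).re ≤ (∑ i, ∑ j, (M.toBlocks₁₂ i j * Y i j).re) +
        ∑ i, W i * (M i i).re := by
    rw [← hf]
    have h0 (i) := re_diag_nonneg hM i
    set S := ∑ i, (M i i).re with hS
    rcases (Finset.sum_nonneg fun i _ => h0 i : 0 ≤ S).eq_or_lt with hS0 | hSpos
    · have hz (i) : (M i i).re = 0 :=
        (Finset.sum_eq_zero_iff_of_nonneg fun i _ => h0 i).1 hS0.symm i (Finset.mem_univ i)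
      have hz2 (i j) : M i j = 0 := by
        have := posSemidef_norm_entry_le hM (a := 0) (b := 0) (i := i) (j := j)
          (by simp [hz]) (by simp [hz]) le_rfl le_rfl
        simpa using this
      have e1 : M.toBlocks₁₂ = 0 := by ext i j; exact hz2 _ _
      have e2 : (fun i => (M i i).re) = 0 := funext hz
      have e3 : ((M.toBlocks₁₂, fun i => (M i i).re) : E) = 0 := by rw [e1, e2]; rfl
      have e4 : S = 0 := hS0.symm
      rw [e4, e3, map_zero]; simp
    · have := h1 (φ (S⁻¹ • (M, fun i => (M i i).re))) ⟨_, ⟨PosSemidef.smul hM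
        (inv_nonneg.2 hSpos.le), fun i => by simp, ?_⟩, rfl⟩
      · rw [map_smul, map_smul, smul_eq_mul, inv_mul_lt_iff₀ hSpos] at this
        have e : φ (M, fun i => (M i i).re) = (M.toBlocks₁₂, fun i => (M i i).re) := rfl
        rw [e] at this
        rw [hε]
        linarith
      · simp only [Prod.smul_snd, Pi.smul_apply, smul_eq_mul]
        rw [← Finset.mul_sum, inv_mul_cancel₀ hSpos.ne']
  have hrank (b : Fin m ⊕ Fin n → ℂ) : ε * ∑ i, ‖b i‖ ^ 2 ≤
      (∑ i, ∑ j, (b (Sum.inl i) * conj (b (Sum.inr j)) * Y i j).re) +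
        ∑ i, W i * ‖b i‖ ^ 2 := by
    have h := hdom _ (posSemidef_vecMulVec_self_star b)
    have e (i) : (vecMulVec b (star b) i i).re = ‖b i‖ ^ 2 := by
      rw [vecMulVec_apply, Pi.star_apply, RCLike.star_def, Complex.mul_conj,
        Complex.normSq_eq_norm_sq, Complex.ofReal_re]
    simp only [e] at h
    exact h
  have hW (i) : ε ≤ W i := by
    have h := hrank (Pi.single i 1)
    have e1 : ∀ l, ‖(Pi.single i 1 : Fin m ⊕ Fin n → ℂ) l‖ ^ 2 = if l = i then 1 else 0 := by
      intro l; by_cases hl : l = i <;> simp [hl]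
    have e2 : ∀ k j, (Pi.single i 1 : Fin m ⊕ Fin n → ℂ) (Sum.inl k) *
        conj ((Pi.single i 1 : Fin m ⊕ Fin n → ℂ) (Sum.inr j)) = 0 := by
      intro k j; rcases i with i | i <;> simp [Pi.single_apply]
    simpa [e1, e2] using h
  -- Giving up only half of the margin `ε` keeps the weights strictly positive. The other half gives
  -- the strict gap `(m + n) * ε / 2` that contradicts `0 ≤ f p₀`.
  have hfin := schur_pairing_nonneg hX Y (fun i => W (Sum.inl i) - ε / 2)
    (fun j => W (Sum.inr j) - ε / 2) (fun i => by linarith [hW (Sum.inl i)])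
    (fun j => by linarith [hW (Sum.inr j)]) fun a c => by
      have h := hrank (Sum.elim a fun j => conj (c j))
      simp only [Fintype.sum_sum_type, Sum.elim_inl, Sum.elim_inr, Complex.conj_conj,
        RCLike.norm_conj] at h
      simp only [sub_mul, Finset.sum_sub_distrib, ← Finset.mul_sum]
      have n1 : 0 ≤ ∑ i, ‖a i‖ ^ 2 := by positivity
      have n2 : 0 ≤ ∑ j, ‖c j‖ ^ 2 := by positivity
      nlinarith [mul_nonneg hεpos.le n1, mul_nonneg hεpos.le n2]
  have hval := hf X fun _ => 1
  simp only [mul_one, Fintype.sum_sum_type] at hval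
  simp only [Finset.sum_sub_distrib, Finset.sum_const, Finset.card_univ, Fintype.card_fin,
    nsmul_eq_mul] at hfin
  have hm' : (0 : ℝ) < m := by exact_mod_cast hm
  have hn' : (0 : ℝ) ≤ n := by positivity
  have hp' : 0 ≤ f (X, fun _ => 1) := hp
  nlinarith [mul_pos hεpos hm', mul_nonneg hεpos.le hn']

end Grothendieck

namespace Grothendieck

open ComplexConjugate ComplexOrder Matrix

/-! ### Rank one matrices and the main theorem -/

/-- The disc is the convex hull of the circle, and convex hulls commute with products. -/
lemma polydisc_subset {ι : Type*} [Finite ι] {s : Set (ι → ℂ)} (hs : Convex ℝ s)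
    (h : ∀ u : ι → ℂ, (∀ i, ‖u i‖ = 1) → u ∈ s) {u : ι → ℂ} (hu : ∀ i, ‖u i‖ ≤ 1) : u ∈ s := by
  have h1 : convexHull ℝ (Set.pi Set.univ fun _ : ι => Metric.sphere (0 : ℂ) 1) ⊆ s :=
    convexHull_min (fun u hu => h u fun i => by simpa using hu i (Set.mem_univ i)) hs
  apply h1
  rw [convexHull_pi]
  intro i _
  rw [convexHull_sphere_eq_closedBall (0 : ℂ) zero_le_one]
  simpa using hu i

lemma convex_rankOneHull (m n : ℕ) : Convex ℝ (rankOneHull m n) :=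
  (convex_convexHull ℝ _).closure

lemma vecMulVec_mem_rankOneHull {m n : ℕ} {u : Fin m → ℂ} {v : Fin n → ℂ}
    (hu : ∀ i, ‖u i‖ ≤ 1) (hv : ∀ j, ‖v j‖ ≤ 1) : vecMulVec u v ∈ rankOneHull m n := by
  have h (u : Fin m → ℂ) (hu : ∀ i, ‖u i‖ ≤ 1) (v : Fin n → ℂ) (hv : ∀ j, ‖v j‖ = 1) :
      vecMulVec u v ∈ rankOneHull m n := by
    refine polydisc_subset (s := {u | vecMulVec u v ∈ rankOneHull m n}) ?_ (fun u hu => ?_) hu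
    · intro a ha b hb s t hs ht hst
      have := convex_rankOneHull m n ha hb hs ht hst
      simpa only [Set.mem_ofPred_eq, add_vecMulVec, smul_vecMulVec] using this
    · exact subset_closure (subset_convexHull ℝ _ ⟨u, v, hu, hv, rfl⟩)
  refine polydisc_subset (s := {v | vecMulVec u v ∈ rankOneHull m n}) ?_ (fun v hv => h u hu v hv) hv
  intro a ha b hb s t hs ht hst
  have := convex_rankOneHull m n ha hb hs ht hst
  simpa only [Set.mem_ofPred_eq, vecMulVec_add, vecMulVec_smul] using this

lemma block_mem_rankOneHull {m n : ℕ} {μ : Type*} (e : Fin m ⊕ Fin n → μ) {A : Matrix μ μ ℂ}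
    (hA : A ∈ polydiscHull μ) : (A.submatrix e e).toBlocks₁₂ ∈ rankOneHull m n := by
  have hcont : Continuous fun A : Matrix μ μ ℂ => (A.submatrix e e).toBlocks₁₂ :=
    continuous_pi fun i => continuous_pi fun j => by
      change Continuous fun A : Matrix μ μ ℂ => A (e (Sum.inl i)) (e (Sum.inr j))
      fun_prop
  have hconv : Convex ℝ {A : Matrix μ μ ℂ | (A.submatrix e e).toBlocks₁₂ ∈ rankOneHull m n} :=
    fun _ ha _ hb _ _ hs ht hst => convex_rankOneHull m n ha hb hs ht hst
  refine closure_minimal (convexHull_min ?_ hconv) (isClosed_closure.preimage hcont) hA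
  rintro _ ⟨a, ha, rfl⟩
  exact vecMulVec_mem_rankOneHull (u := fun i => a (e (Sum.inl i)))
    (v := fun j => star (a (e (Sum.inr j)))) (fun i => ha _) fun j => by simpa using ha _

/-- The off-diagonal blocks of positive matrices with diagonal at most `r`. -/
def blockSet (m n : ℕ) (r : ℝ) : Set (Matrix (Fin m) (Fin n) ℂ) :=
  {Z | ∃ M : Matrix (Fin m ⊕ Fin n) (Fin m ⊕ Fin n) ℂ, M.PosSemidef ∧
    (∀ i, (M i i).re ≤ r) ∧ M.toBlocks₁₂ = Z}

lemma norm_entry_le_of_mem_blockSet {m n : ℕ} {r : ℝ} (hr : 0 ≤ r)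
    {Z : Matrix (Fin m) (Fin n) ℂ} (hZ : Z ∈ blockSet m n r) (i : Fin m) (j : Fin n) :
    ‖Z i j‖ ≤ r := by
  obtain ⟨M, hM, hd, rfl⟩ := hZ
  have hs : √r ^ 2 = r := Real.sq_sqrt hr
  have := posSemidef_norm_entry_le hM (a := √r) (b := √r) (i := Sum.inl i) (j := Sum.inr j)
    (by rw [hs]; exact hd _) (by rw [hs]; exact hd _) (Real.sqrt_nonneg _) (Real.sqrt_nonneg _)
  rwa [Real.mul_self_sqrt hr] at this

lemma smul_mem_blockSet {m n : ℕ} {r c : ℝ} (hc : 0 ≤ c) {Z : Matrix (Fin m) (Fin n) ℂ}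
    (hZ : Z ∈ blockSet m n r) : c • Z ∈ blockSet m n (c * r) := by
  obtain ⟨M, hM, hd, rfl⟩ := hZ
  refine ⟨c • M, PosSemidef.smul hM hc, fun i => ?_, rfl⟩
  rw [Matrix.smul_apply, Complex.smul_re, smul_eq_mul]
  exact mul_le_mul_of_nonneg_left (hd i) hc

/-- Conjugation by `diag(1, -1)` keeps positivity and the diagonal and changes the sign of the
off-diagonal block. -/
lemma neg_mem_blockSet {m n : ℕ} {r : ℝ} {Z : Matrix (Fin m) (Fin n) ℂ}
    (hZ : Z ∈ blockSet m n r) : -Z ∈ blockSet m n r := by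
  obtain ⟨M, hM, hd, rfl⟩ := hZ
  let d : Fin m ⊕ Fin n → ℂ := Sum.elim (fun _ => 1) fun _ => -1
  have hdM (i j) : ((diagonal d)ᴴ * M * diagonal d) i j = star (d i) * M i j * d j := by
    rw [diagonal_conjTranspose, mul_diagonal, diagonal_mul, Pi.star_apply]
  refine ⟨_, hM.conjTranspose_mul_mul_same (diagonal d), fun i => ?_, ?_⟩
  · rw [hdM]
    refine le_trans (le_of_eq ?_) (hd i)
    rcases i with i | i <;> simp [d]
  · ext i j
    rw [toBlocks₁₂, Matrix.of_apply, hdM]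
    simp [d, toBlocks₁₂]

lemma exists_sub_mem_blockSet {m n : ℕ} {Z : Matrix (Fin m) (Fin n) ℂ}
    (hZ : Z ∈ blockSet m n 1) :
    ∃ V ∈ rankOneHull m n, littleGrothendieckConst • V - Z ∈
      blockSet m n (littleGrothendieckConst - 1) := by
  obtain ⟨M₀, hM₀, hd₀, rfl⟩ := hZ
  -- Adding `D` makes the diagonal exactly one without touching the block; only then is the diagonal
  -- of `k • A - M` at most `k - 1`.
  let D : Matrix (Fin m ⊕ Fin n) (Fin m ⊕ Fin n) ℂ :=
    diagonal fun i => ((1 - (M₀ i i).re : ℝ) : ℂ)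
  have hD : D.PosSemidef := PosSemidef.diagonal fun i => by
    exact Complex.zero_le_real.2 (sub_nonneg.2 (hd₀ i))
  obtain ⟨M, hMeq⟩ : ∃ M, M = M₀ + D := ⟨_, rfl⟩
  have hM : M.PosSemidef := hMeq ▸ hM₀.add hD
  have hd (i) : (M i i).re = 1 := by simp [hMeq, D]
  have hblock : M.toBlocks₁₂ = M₀.toBlocks₁₂ := by
    ext i j
    simp [hMeq, D, toBlocks₁₂]
  rw [← hblock]
  let e : Fin m ⊕ Fin n ≃ Fin (m + n) := finSumFinEquiv
  obtain ⟨A, hA, hp⟩ := exists_polydiscHull_sub_posSemidef (C := M.submatrix e.symm e.symm)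
    (hM.submatrix _) fun i => (hd _).le
  have hQ : ((littleGrothendieckConst • A - M.submatrix e.symm e.symm).submatrix e e) =
      littleGrothendieckConst • A.submatrix e e - M := by
    ext i j
    simp
  refine ⟨_, block_mem_rankOneHull e hA, littleGrothendieckConst • A.submatrix e e - M,
    hQ ▸ hp.submatrix e, fun i => ?_, rfl⟩
  rw [Matrix.sub_apply, Complex.sub_re, hd, Matrix.smul_apply, Complex.smul_re, smul_eq_mul]
  have := (Complex.re_le_norm _).trans (norm_entry_le_of_mem_polydiscHull hA (e i) (e i))
  exact sub_le_sub_right (mul_le_of_le_one_right littleGrothendieckConst_nonneg this) 1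

/-- A functional bounded by `h` on the rank one hull is bounded by `k / (2 - k) * h` on the
off-diagonal blocks. -/
lemma functional_le {m n : ℕ} (f : StrongDual ℝ (Matrix (Fin m) (Fin n) ℂ)) {h : ℝ}
    (hf : ∀ V ∈ rankOneHull m n, f V ≤ h) {Z : Matrix (Fin m) (Fin n) ℂ}
    (hZ : Z ∈ blockSet m n 1) :
    f Z ≤ littleGrothendieckConst / (2 - littleGrothendieckConst) * h := by
  set k := littleGrothendieckConst
  have hk1 : 1 ≤ k := one_le_littleGrothendieckConst
  have hk2 : k < 2 := littleGrothendieckConst_lt_two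
  obtain ⟨Y, hY⟩ := exists_eq_sum_re_mul f.toLinearMap
  have hbdd : BddAbove (f '' blockSet m n 1) := by
    refine ⟨∑ i, ∑ j, ‖Y i j‖, ?_⟩
    rintro _ ⟨W, hW, rfl⟩
    refine (hY W).trans_le (Finset.sum_le_sum fun i _ => Finset.sum_le_sum fun j _ => ?_)
    refine (Complex.re_le_norm _).trans ?_
    rw [norm_mul]
    exact mul_le_of_le_one_left (norm_nonneg _)
      (norm_entry_le_of_mem_blockSet zero_le_one hW i j)
  set s := sSup (f '' blockSet m n 1)
  have hle (W) (hW : W ∈ blockSet m n 1) : f W ≤ s := le_csSup hbdd ⟨W, hW, rfl⟩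
  have hscale (r : ℝ) (hr : 0 ≤ r) (W) (hW : W ∈ blockSet m n r) : f W ≤ r * s := by
    rcases hr.eq_or_lt with rfl | hr
    · have : W = 0 := by
        ext i j
        simpa using norm_entry_le_of_mem_blockSet le_rfl hW i j
      simp [this]
    · have h1 := smul_mem_blockSet (inv_nonneg.2 hr.le) hW
      rw [inv_mul_cancel₀ hr.ne'] at h1
      have h2 := hle _ h1
      rwa [map_smul, smul_eq_mul, inv_mul_le_iff₀ hr] at h2
  -- Each `W` is `k • V` plus the negative of an element of `blockSet m n (k - 1)`, and that
  -- negative is again in this set.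
  have hs : s ≤ k * h + (k - 1) * s := by
    refine csSup_le ⟨_, Z, hZ, rfl⟩ ?_
    rintro _ ⟨W, hW, rfl⟩
    obtain ⟨V, hV, hD⟩ := exists_sub_mem_blockSet hW
    have h1 := hscale _ (by linarith) _ (neg_mem_blockSet hD)
    rw [map_neg, map_sub, map_smul, smul_eq_mul] at h1
    have h2 := mul_le_mul_of_nonneg_left (hf V hV) (zero_le_one.trans hk1)
    linarith
  refine (hle Z hZ).trans ?_
  rw [div_mul_eq_mul_div, le_div_iff₀ (by linarith)]
  linarith

open scoped Matrix.Norms.L2Operator in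
lemma schurNorm_fin_zero {n : ℕ} (X : Matrix (Fin 0) (Fin n) ℂ) : schurNorm X = 0 := by
  refine le_antisymm (ContinuousLinearMap.opNorm_le_bound _ le_rfl fun A => ?_)
    (norm_nonneg (schurMap X))
  rw [Subsingleton.elim (schurMap X A) 0, norm_zero, zero_mul]

end Grothendieck

open Grothendieck in
theorem mainTheorem4 (m n : ℕ) (X : Matrix (Fin m) (Fin n) ℂ)
    (hX : Grothendieck.schurNorm X = 1) :
    X ∈ (Grothendieck.littleGrothendieckConst / (2 - Grothendieck.littleGrothendieckConst)) •
      Grothendieck.rankOneHull m n := by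
  have hm : 0 < m := by
    rcases Nat.eq_zero_or_pos m with rfl | hm
    · exact absurd ((schurNorm_fin_zero X).symm.trans hX) zero_ne_one
    · exact hm
  have hXb : X ∈ blockSet m n 1 := exists_posSemidef_block hm hX.le
  set K := littleGrothendieckConst / (2 - littleGrothendieckConst) with hK
  have hKpos : 0 < K := div_pos (zero_lt_one.trans_le one_le_littleGrothendieckConst)
    (by linarith [littleGrothendieckConst_lt_two])
  by_contra hcon
  obtain ⟨f, u, h1, h2⟩ := geometric_hahn_banach_closed_point
    ((convex_rankOneHull m n).smul K)
    (isClosed_closure.smul_of_ne_zero hKpos.ne' : IsClosed (K • rankOneHull m n)) hcon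
  have h3 := functional_le f (h := u / K) (fun V hV => by
    have := h1 (K • V) (Set.smul_mem_smul_set hV)
    rw [map_smul, smul_eq_mul] at this
    rw [le_div_iff₀ hKpos]
    linarith) hXb
  rw [← hK, mul_div_cancel₀ _ hKpos.ne'] at h3
  linarith
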